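/- **Setting.** Let $O_i=(L_{0,i},A_{0,i},L_{1,i},A_{1,i})$, $i=1,2,\dots$, be i.i.d. with $L_0\in\mathbb R^{p_0}$, $L_1\in\mathbb R^{p_1}$ and $A_0,A_1\in\{0,1\}$. Fix sets of selected covariates $J_{00},J_{10}\subseteq\{1,\dots,p_0\}$ and $J_{11}\subseteq\{1,\dots,p_1\}$, and consider the pooled logistic treatment model $$\operatorname{logit} m_0(O;\alpha)=\alpha_{0,-1}+\sum_{k\in J_{00}}\alpha_{0,0,k}L_{0,k},\qquad \operatorname{logit} m_1(O;\alpha)=\alpha_{1,-1}+\sum_{k\in J_{10}}\alpha_{1,0,k}L_{0,k}+\sum_{k\in J_{11}}\alpha_{1,1,k}L_{1,k}+\alpha_{1,2}A_0 ,$$ with free parameter vector $\alpha$ collecting all the displayed coefficients. Write $X_0$ and $X_1$ for the vectors of regressors of the two models, each padded with zeros to the length of $\alpha$, so that $\operatorname{logit} m_\tau=X_\tau^{T}\alpha$. Suppose that the model is correct at $\alpha^*$: given $(L_{0,k})_{k\in J_{00}}$, $A_0$ is Bernoulli with mean $m_0(O;\alpha^*)$, and given $A_0$, $(L_{0,k})_{k\in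 J_{10}}$ and $(L_{1,k})_{k\in J_{11}}$, $A_1$ is Bernoulli with mean $m_1(O;\alpha^*)$. **Estimator.** Let $\gamma_1>0$ and $\lambda_{1,n}\ge 0$. Let $\tilde\alpha=\tilde\alpha^{(n)}$ be random vectors such that $\tilde\alpha_{0,0,k}$ and $\tilde\alpha_{1,0,k}$ are $\sqrt n$-consistent for $\alpha^*_{0,0,k}$ and $\alpha^*_{1,0,k}$ for each $k\in J_{00}\cap J_{10}$. Let $\hat\alpha=\hat\alpha^{(n)}$ be a random vector which, whenever a minimizer exists, is a minimizer of $$-\sum_{\tau=0}^1\sum_{i=1}^n\bigl[A_{\tau,i}\log m_\tau(O_i;\alpha)+(1-A_{\tau,i})\log\{1-m_\tau(O_i;\alpha)\}\bigr]+\lambda_{1,n}\sum_{k\in J_{00}\cap J_{10}}\frac{|\alpha_{1,0,k}-\alpha_{0,0,k}|}{|\tilde\alpha_{1,0,k}-\tilde\alpha_{0,0,k}|^{\gamma_1}} ,$$ where a term with zero denominator is $0$ if $\alpha_{1,0,k}=\alpha_{0,0,k}$ and $+\infty$ otherwise, and $0\cdot\infty=0$. **Graph.** Let $V$ be the set of the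 indices of all covariate coefficients in the model (that is, $(0,0,k)$ for $k\in J_{00}$, $(1,0,k)$ for $k\in J_{10}$ and $(1,1,k)$ for $k\in J_{11}$) and $E=\{\{(0,0,k),(1,0,k)\}:k\in J_{00}\cap J_{10}\}$. Let $\mathcal B\subseteq E$ be the set of edges with $\alpha^*_{0,0,k}=\alpha^*_{1,0,k}$, let $\mathcal B_n\subseteq E$ be the set of edges with $\hat\alpha_{0,0,k}=\hat\alpha_{1,0,k}$, and let $s_0$ be the number of connected components of $(V,\mathcal B)$. For a vector $\alpha$ let $\alpha_{\mathcal B}$ be $\alpha$ with the coordinates $(1,0,k)$ of the edges in $\mathcal B$ removed. **Regularity assumptions.** (AL1) The Fisher information $I(\alpha^*)=\sum_{\tau}E[m_\tau(1-m_\tau)X_\tau X_\tau^{T}]$, with $m_\tau=m_\tau(O;\alpha^*)$, is finite (every entry of each summand is integrable) and positive definite. (AL2) There are an open neighbourhood $U$ of $\alpha^*$ and functions $M_0,M_1$ of $O$ such that, for each $\tau$, almost surely $|\phi'''(X_\tau^{T}\alpha)|\le M_\tau$ for all $\alpha\in U$, where $\phi(t)=\log(1+e^t)$, and $E[M_\tau|X_{\tau,j}X_{\tau,k}X_{\tau,l}|]<\infty$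 for all $j,k,l$. **Theorem.** Assume in addition that $\lambda_{1,n}/\sqrt n\to0$ and $\lambda_{1,n}n^{(\gamma_1-1)/2}\to\infty$ as $n\to\infty$. Then 1. $P(\mathcal B_n=\mathcal B)\to1$; 2. the vector $\alpha_{\mathcal B}$ has dimension $s_0+3$, and $\sqrt n(\hat\alpha_{\mathcal B}-\alpha^*_{\mathcal B})$ converges in distribution to a mean-zero Gaussian distribution on $\mathbb R^{s_0+3}$. Its (positive semidefinite) covariance matrix is $H^{-1}\Sigma H^{-1}$, where $H=R^{T}I(\alpha^*)R$, $\Sigma=R^{T}E[\psi\psi^{T}]R$, $\psi=\sum_\tau(A_\tau-m_\tau(O;\alpha^*))X_\tau$, and $R$ is the $0$-$1$ matrix that recovers a full vector from its reduced vector by giving $(1,0,k)$ the value at $(0,0,k)$ for each edge in $\mathcal B$. -/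

import Mathlib

open MeasureTheory ProbabilityTheory Filter Topology
open scoped ENNReal Matrix

namespace FusedLasso

/-- One subject's record `(L₀, A₀, L₁, A₁)`: baseline covariates, first treatment,
time-one covariates, second treatment. -/
abbrev Obs (p₀ p₁ : ℕ) : Type := (Fin p₀ → ℝ) × Bool × (Fin p₁ → ℝ) × Bool

/-- The binary treatment `A_τ`, as a real number in `{0, 1}`. -/
def trt {p₀ p₁ : ℕ} (τ : Fin 2) (o : Obs p₀ p₁) : ℝ :=
  match τ with
  | 0 => if o.2.1 then 1 else 0
  | 1 => if o.2.2.2 then 1 else 0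

/-- Indices of the free coefficients of the pooled logistic treatment model after variable
selection. `J₀₀` and `J₁₀` are the components of `L₀` kept in the models for `A₀` and `A₁`, and
`J₁₁` the components of `L₁` kept in the model for `A₁`. All other covariate coefficients are
fixed at zero, so that they do not appear as indices. -/
inductive Coef {p₀ p₁ : ℕ} (J₀₀ J₁₀ : Finset (Fin p₀)) (J₁₁ : Finset (Fin p₁)) : Type
  /-- intercept of the model for `A₀` -/
  | icpt0
  /-- coefficient of `L₀ₖ` in the model for `A₀` -/
  | base0 (k : J₀₀)
  /-- intercept of the model for `A₁` -/
  | icpt1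
  /-- coefficient of `L₀ₖ` in the model for `A₁` -/
  | base1 (k : J₁₀)
  /-- coefficient of `L₁ₖ` in the model for `A₁` -/
  | cov1 (k : J₁₁)
  /-- coefficient of `A₀` in the model for `A₁` -/
  | trt1
  deriving DecidableEq, Fintype

section

variable {p₀ p₁ : ℕ} {J₀₀ J₁₀ : Finset (Fin p₀)} {J₁₁ : Finset (Fin p₁)}

/-- The regressors of the row `τ` of the pooled data. -/
def design (τ : Fin 2) (o : Obs p₀ p₁) (c : Coef J₀₀ J₁₀ J₁₁) : ℝ :=
  match τ, c with
  | 0, .icpt0 => 1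
  | 0, .base0 k => o.1 k
  | 1, .icpt1 => 1
  | 1, .base1 k => o.1 k
  | 1, .cov1 k => o.2.2.1 k
  | 1, .trt1 => trt 0 o
  | _, _ => 0

/-- The modelled treatment probability `m_τ(L₀, L₁, A₀; α)`. -/
noncomputable def prob (τ : Fin 2) (o : Obs p₀ p₁) (α : Coef J₀₀ J₁₀ J₁₁ → ℝ) : ℝ :=
  Real.sigmoid (∑ c, α c * design τ o c)

/-- The pooled negative Bernoulli log-likelihood of the first `n` subjects. -/
noncomputable def negLogLik (n : ℕ) (x : ℕ → Obs p₀ p₁) (α : Coef J₀₀ J₁₀ J₁₁ → ℝ) : ℝ :=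
  ∑ τ : Fin 2, ∑ i ∈ Finset.range n,
    -(trt τ (x i) * Real.log (prob τ (x i) α)
      + (1 - trt τ (x i)) * Real.log (1 - prob τ (x i) α))

theorem negLogLik_nonneg (n : ℕ) (x : ℕ → Obs p₀ p₁) (α : Coef J₀₀ J₁₀ J₁₁ → ℝ) :
    0 ≤ negLogLik n x α := by
  refine Finset.sum_nonneg fun τ _ => Finset.sum_nonneg fun i _ => ?_
  have h0 : 0 < prob τ (x i) α := Real.sigmoid_pos _
  have h1 : prob τ (x i) α < 1 := Real.sigmoid_lt_one _
  have l0 : Real.log (prob τ (x i) α) ≤ 0 := Real.log_nonpos h0.le h1.le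
  have l1 : Real.log (1 - prob τ (x i) α) ≤ 0 :=
    Real.log_nonpos (by linarith) (by linarith)
  have t0 : 0 ≤ trt τ (x i) := by
    unfold trt; split <;> split_ifs <;> norm_num
  have t1 : 0 ≤ 1 - trt τ (x i) := by
    unfold trt; split <;> split_ifs <;> norm_num
  nlinarith [mul_nonneg t0 (neg_nonneg.2 l0), mul_nonneg t1 (neg_nonneg.2 l1)]

/-- The index `(0, 0, k)` of a baseline covariate that was kept at both times. -/
def common0 (k : ↥(J₀₀ ∩ J₁₀)) : Coef J₀₀ J₁₀ J₁₁ :=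
  .base0 ⟨k, (Finset.mem_inter.1 k.2).1⟩

/-- The index `(1, 0, k)` of a baseline covariate that was kept at both times. -/
def common1 (k : ↥(J₀₀ ∩ J₁₀)) : Coef J₀₀ J₁₀ J₁₁ :=
  .base1 ⟨k, (Finset.mem_inter.1 k.2).2⟩

/-- The adaptive fusion penalty `∑ₖ |α₁₀ₖ - α₀₀ₖ| / |α̃₁₀ₖ - α̃₀₀ₖ| ^ γ`. Division is that of
`[0, ∞]`: if the initial estimates coincide, then the weight is infinite, and the term is `0`
when `α₁₀ₖ = α₀₀ₖ` and `∞` otherwise. -/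
noncomputable def fusionPenalty (γ : ℝ) (αinit α : Coef J₀₀ J₁₀ J₁₁ → ℝ) : ℝ≥0∞ :=
  ∑ k : ↥(J₀₀ ∩ J₁₀),
    ENNReal.ofReal |α (common1 k) - α (common0 k)|
      / ENNReal.ofReal (|αinit (common1 k) - αinit (common0 k)| ^ γ)

/-- The adaptive fused LASSO criterion, with values in `[0, ∞]`; nothing is truncated, by
`negLogLik_nonneg`. -/
noncomputable def criterion (lam γ : ℝ) (n : ℕ) (x : ℕ → Obs p₀ p₁)
    (αinit α : Coef J₀₀ J₁₀ J₁₁ → ℝ) : ℝ≥0∞ :=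
  ENNReal.ofReal (negLogLik n x α) + ENNReal.ofReal lam * fusionPenalty γ αinit α

/-- `α` is a global minimizer of the adaptive fused LASSO criterion. -/
def IsMinimizer (lam γ : ℝ) (n : ℕ) (x : ℕ → Obs p₀ p₁)
    (αinit α : Coef J₀₀ J₁₀ J₁₁ → ℝ) : Prop :=
  ∀ β : Coef J₀₀ J₁₀ J₁₁ → ℝ, criterion lam γ n x αinit α ≤ criterion lam γ n x αinit β

/-! ### The fusion graph -/

/-- The coefficients of covariates, that is all but the intercepts and the coefficient of `A₀`. -/
def IsCovariate : Coef J₀₀ J₁₀ J₁₁ → Prop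
  | .base0 _ => True
  | .base1 _ => True
  | .cov1 _ => True
  | _ => False

/-- The vertices of the fusion graph: the covariate coefficients in the model. -/
abbrev Vertex (J₀₀ J₁₀ : Finset (Fin p₀)) (J₁₁ : Finset (Fin p₁)) : Type :=
  {c : Coef J₀₀ J₁₀ J₁₁ // IsCovariate c}

/-- The fusion graph: its edges join `(0, 0, k)` and `(1, 0, k)` for the common `k`. -/
def fusionGraph (J₀₀ J₁₀ : Finset (Fin p₀)) (J₁₁ : Finset (Fin p₁)) :
    SimpleGraph (Vertex J₀₀ J₁₀ J₁₁) :=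
  SimpleGraph.fromRel fun u v => ∃ k : ↥(J₀₀ ∩ J₁₀), u.1 = common0 k ∧ v.1 = common1 k

/-- The edges of the fusion graph on whose two ends the coefficients of `α` are equal. It is `𝓑`
for the true parameter and `𝓑ₙ` for the estimator. -/
def fusedEdges (α : Coef J₀₀ J₁₀ J₁₁ → ℝ) : Set (Sym2 (Vertex J₀₀ J₁₀ J₁₁)) :=
  {e | e ∈ (fusionGraph J₀₀ J₁₀ J₁₁).edgeSet ∧ ∀ u ∈ e, ∀ v ∈ e, α u.1 = α v.1}

/-- The number of connected components of the graph `(V, 𝓑)`. -/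
noncomputable def numComponents (α : Coef J₀₀ J₁₀ J₁₁ → ℝ) : ℕ :=
  Nat.card (SimpleGraph.fromEdgeSet (fusedEdges α)).ConnectedComponent

/-! ### The reduced parameter -/

open Classical in
/-- Sends `(1, 0, k)` to `(0, 0, k)` if `k` is common and `α` takes the same value at both, and
fixes every other index. -/
noncomputable def collapse (α : Coef J₀₀ J₁₀ J₁₁ → ℝ) :
    Coef J₀₀ J₁₀ J₁₁ → Coef J₀₀ J₁₀ J₁₁
  | .base1 k =>
      if h : (k : Fin p₀) ∈ J₀₀ then
        if α (.base0 ⟨k, h⟩) = α (.base1 k) then .base0 ⟨k, h⟩ else .base1 k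
      else .base1 k
  | c => c

/-- The indices of the reduced parameter `α_𝓑`: all coefficients except the redundant `(1, 0, k)`,
those equal to their partner `(0, 0, k)`. -/
abbrev Reduced (α : Coef J₀₀ J₁₀ J₁₁ → ℝ) : Type :=
  {c : Coef J₀₀ J₁₀ J₁₁ // collapse α c = c}

/-- The 0-1 matrix of the linear map that takes a reduced parameter to the full one. -/
noncomputable def expandMatrix (α : Coef J₀₀ J₁₀ J₁₁ → ℝ) :
    Matrix (Coef J₀₀ J₁₀ J₁₁) (Reduced α) ℝ :=
  Matrix.of fun c r => if collapse α c = r.1 then 1 else 0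

/-! ### Assumptions on the distribution `P` of one record -/

/-- Given the kept components of `L₀`, `A₀` is Bernoulli with success probability `m₀(· ; α)`, and
given `A₀` and the kept components of `(L₀, L₁)`, `A₁` is Bernoulli with success probability
`m₁(· ; α)`. -/
def CorrectModel (P : Measure (Obs p₀ p₁)) (α : Coef J₀₀ J₁₀ J₁₁ → ℝ) : Prop :=
  (P[trt 0 | MeasurableSpace.comap
      (fun (o : Obs p₀ p₁) (k : J₀₀) => o.1 k) inferInstance]
    =ᵐ[P] fun o => prob 0 o α) ∧
  (P[trt 1 | MeasurableSpace.comap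
      (fun o : Obs p₀ p₁ => (o.2.1, (fun k : J₁₀ => o.1 k), fun k : J₁₁ => o.2.2.1 k))
      inferInstance]
    =ᵐ[P] fun o => prob 1 o α)

/-- The Fisher information matrix of the pooled logistic model,
`∑_τ E[m_τ (1 - m_τ) X_τ X_τᵀ]`. -/
noncomputable def fisherInfo (P : Measure (Obs p₀ p₁)) (α : Coef J₀₀ J₁₀ J₁₁ → ℝ) :
    Matrix (Coef J₀₀ J₁₀ J₁₁) (Coef J₀₀ J₁₀ J₁₁) ℝ :=
  Matrix.of fun c d => ∑ τ : Fin 2,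
    ∫ o, prob τ o α * (1 - prob τ o α) * design τ o c * design τ o d ∂P

/-- First regularity condition: the Fisher information is finite and positive definite. -/
def FisherRegular (P : Measure (Obs p₀ p₁)) (α : Coef J₀₀ J₁₀ J₁₁ → ℝ) : Prop :=
  (∀ (τ : Fin 2) (c d : Coef J₀₀ J₁₀ J₁₁), Integrable
    (fun o => prob τ o α * (1 - prob τ o α) * design τ o c * design τ o d) P) ∧
  (fisherInfo P α).PosDef

/-- Second regularity condition: on an open set around `α`, the third derivative
`m (1 - m) (1 - 2 m)` of the log-partition function `log (1 + exp t)`, taken at the linear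
predictor, is dominated by some `M`, and `E[M |X_c X_d X_e|]` is finite for all regressors
`X_c, X_d, X_e`. -/
def ThirdDerivDominated (P : Measure (Obs p₀ p₁)) (α : Coef J₀₀ J₁₀ J₁₁ → ℝ) : Prop :=
  ∃ (U : Set (Coef J₀₀ J₁₀ J₁₁ → ℝ)) (M : Fin 2 → Obs p₀ p₁ → ℝ),
    IsOpen U ∧ α ∈ U ∧
    (∀ τ : Fin 2, ∀ᵐ o ∂P, ∀ β ∈ U,
      |prob τ o β * (1 - prob τ o β) * (1 - 2 * prob τ o β)| ≤ M τ o) ∧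
    ∀ (τ : Fin 2) (c d e : Coef J₀₀ J₁₀ J₁₁), Integrable
      (fun o => M τ o * |design τ o c * design τ o d * design τ o e|) P

/-! ### The limit law -/

/-- The score of one record in the pooled model, `∑_τ (A_τ - m_τ) X_τ`. -/
noncomputable def score (o : Obs p₀ p₁) (α : Coef J₀₀ J₁₀ J₁₁ → ℝ)
    (c : Coef J₀₀ J₁₀ J₁₁) : ℝ :=
  ∑ τ : Fin 2, (trt τ o - prob τ o α) * design τ o c

/-- The second moment matrix of the score. -/
noncomputable def scoreCov (P : Measure (Obs p₀ p₁)) (α : Coef J₀₀ J₁₀ J₁₁ → ℝ) :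
    Matrix (Coef J₀₀ J₁₀ J₁₁) (Coef J₀₀ J₁₀ J₁₁) ℝ :=
  Matrix.of fun c d => ∫ o, score o α c * score o α d ∂P

/-- The covariance `H⁻¹ Σ H⁻¹`, where `H` and `Σ` are the Fisher information and the score second
moment of the pooled model in which the truly equal common coefficients are merged. -/
noncomputable def asymptoticCov (P : Measure (Obs p₀ p₁)) (α : Coef J₀₀ J₁₀ J₁₁ → ℝ) :
    Matrix (Reduced α) (Reduced α) ℝ :=
  ((expandMatrix α)ᵀ * fisherInfo P α * expandMatrix α)⁻¹
    * ((expandMatrix α)ᵀ * scoreCov P α * expandMatrix α)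
    * ((expandMatrix α)ᵀ * fisherInfo P α * expandMatrix α)⁻¹

/-- `√n (T_n - t) = O_P(1)`. -/
def IsSqrtConsistent {Ω : Type*} [MeasurableSpace Ω] (μ : Measure Ω) (T : ℕ → Ω → ℝ) (t : ℝ) :
    Prop :=
  ∀ ε : ℝ≥0∞, 0 < ε → ∃ C : ℝ, ∀ᶠ n : ℕ in atTop,
    μ {ω | C < √(n : ℝ) * |T n ω - t|} ≤ ε

end

end FusedLasso

open FusedLasso

/-!
Write `S_n` for the score of the first `n` records divided by `√n`. At the points `α + u / √n` the
negative log-likelihood is `½ uᵀ I u - S_nᵀ u`, up to a constant and an error that tends to zero in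
probability uniformly for bounded `u`: the law of large numbers gives the information matrix, and
the third derivatives are dominated. At this scale the penalty on a pair of unequal coefficients
varies by `O(λ_n / √n) = o(1)`, while the one on a pair of equal coefficients has a slope of order
at least `λ_n n ^ ((γ - 1) / 2) → ∞`, because the initial estimator of the difference is
`O_P(n ^ (-1/2))`. So with high probability exactly the pairs that are equal at `α` are fused, and
convexity of the criterion confines `√n (α̂ - α)` to a small ball around the minimizer
`R (Rᵀ I R)⁻¹ Rᵀ S_n` of the quadratic among the vectors with those pairs fused. The central limit
theorem for `S_n` then gives the limit law.
-/

namespace FusedLasso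

section Softplus

theorem abs_sub_taylor_two_le {f : ℝ → ℝ} (hf : ContDiff ℝ 3 f) {x h K : ℝ}
    (hK : ∀ s ∈ Set.Icc (0 : ℝ) 1, |iteratedDeriv 3 f (x + s * h)| ≤ K) :
    |f (x + h) - (f x + h * deriv f x + h ^ 2 / 2 * iteratedDeriv 2 f x)| ≤ K * |h| ^ 3 / 6 := by
  rcases eq_or_ne h 0 with rfl | hh
  · simp
  have hne : x ≠ x + h := by simpa using hh
  obtain ⟨y, hy, heq⟩ := taylor_mean_remainder_lagrange_iteratedDeriv (n := 2) hne hf.contDiffOn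
  have hwithin : ∀ k : ℕ, k ≤ 3 → iteratedDerivWithin k f (Set.uIcc x (x + h)) x
      = iteratedDeriv k f x := fun k hk =>
    iteratedDerivWithin_eq_iteratedDeriv (uniqueDiffOn_uIcc hne)
      (hf.contDiffAt.of_le (by exact_mod_cast hk)) Set.left_mem_uIcc
  have hpoly : taylorWithinEval f 2 (Set.uIcc x (x + h)) x (x + h)
      = f x + h * deriv f x + h ^ 2 / 2 * iteratedDeriv 2 f x := by
    simp only [taylorWithinEval_succ, taylor_within_zero_eval, hwithin 1 (by norm_num),
      hwithin 2 (by norm_num), iteratedDeriv_one, smul_eq_mul, Nat.factorial, add_sub_cancel_left,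
      zero_add, Nat.reduceAdd]
    push_cast
    ring
  obtain ⟨s, hs, rfl⟩ : ∃ s ∈ Set.Icc (0 : ℝ) 1, x + s * h = y := by
    have := Set.uIoo_subset_uIcc_self hy
    rw [← segment_eq_uIcc, segment_eq_image'] at this
    simpa using this
  rw [← hpoly, heq, abs_div, abs_mul, abs_pow]
  simp only [add_sub_cancel_left, Nat.factorial]
  norm_num
  gcongr
  exact hK s hs

/-- The log-partition function `log (1 + exp t)` of the Bernoulli family. -/
noncomputable def softplus (t : ℝ) : ℝ := Real.log (1 + Real.exp t)

theorem sigmoid_eq_exp_div (t : ℝ) : Real.sigmoid t = Real.exp t / (1 + Real.exp t) := by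
  rw [Real.sigmoid_def, Real.exp_neg]
  field_simp
  ring

theorem log_sigmoid (t : ℝ) : Real.log (Real.sigmoid t) = t - softplus t := by
  rw [sigmoid_eq_exp_div, Real.log_div (Real.exp_pos t).ne' (by positivity), Real.log_exp, softplus]

theorem log_one_sub_sigmoid (t : ℝ) : Real.log (1 - Real.sigmoid t) = -softplus t := by
  rw [← Real.sigmoid_neg, Real.sigmoid_def, neg_neg, Real.log_inv, softplus]

theorem contDiff_softplus {n : WithTop ℕ∞} : ContDiff ℝ n softplus :=
  (contDiff_const.add Real.contDiff_exp).log fun t => by positivity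

theorem deriv_softplus : deriv softplus = Real.sigmoid := by
  ext t
  rw [sigmoid_eq_exp_div]
  exact (((Real.hasDerivAt_exp t).const_add 1).log (by positivity)).deriv

theorem convexOn_softplus : ConvexOn ℝ Set.univ softplus := by
  refine Monotone.convexOn_univ_of_deriv (contDiff_softplus.differentiable one_ne_zero) ?_
  rw [deriv_softplus]
  exact Real.sigmoid_monotone

theorem iteratedDeriv_two_softplus :
    iteratedDeriv 2 softplus = fun t => Real.sigmoid t * (1 - Real.sigmoid t) := by
  rw [iteratedDeriv_succ, iteratedDeriv_one, deriv_softplus]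
  exact funext fun t => (Real.hasDerivAt_sigmoid t).deriv

theorem iteratedDeriv_three_softplus : iteratedDeriv 3 softplus =
    fun t => Real.sigmoid t * (1 - Real.sigmoid t) * (1 - 2 * Real.sigmoid t) := by
  rw [iteratedDeriv_succ, iteratedDeriv_two_softplus]
  ext t
  have h := Real.hasDerivAt_sigmoid t
  exact ((h.mul (h.const_sub 1)).congr_deriv (by ring)).deriv

end Softplus

section Penalized

open scoped NNReal

variable {E κ : Type*} [NormedAddCommGroup E] [NormedSpace ℝ E]

theorem lt_of_forall_sphere_lt {f : E → ℝ≥0∞} (hf : ConvexOn ℝ≥0 Set.univ f) {a b : E}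
    {r : ℝ} (hr : 0 < r) (h : ∀ y ∈ Metric.sphere a r, f a < f y) (hb : r ≤ ‖b - a‖) :
    f a < f b := by
  by_contra! hle
  have hpos : 0 < ‖b - a‖ := hr.trans_le hb
  obtain ⟨t, ht⟩ : ∃ t : ℝ≥0, (t : ℝ) = r / ‖b - a‖ := ⟨⟨_, by positivity⟩, rfl⟩
  have ht1 : t ≤ 1 := by
    rw [← NNReal.coe_le_coe, ht]
    exact div_le_one_of_le₀ hb hpos.le
  have hmem : (1 - t) • a + t • b ∈ Metric.sphere a r := by
    have : (1 - t) • a + t • b - a = (t : ℝ) • (b - a) := by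
      rw [NNReal.smul_def, NNReal.smul_def, NNReal.coe_sub ht1, NNReal.coe_one]
      module
    rw [mem_sphere_iff_norm, this, norm_smul, NNReal.norm_eq, ht, div_mul_cancel₀ _ hpos.ne']
  have hadd : 1 - t + t = 1 := tsub_add_cancel_of_le ht1
  refine (h _ hmem).not_ge ?_
  calc f ((1 - t) • a + t • b)
      ≤ (1 - t) • f a + t • f b := hf.2 trivial trivial zero_le zero_le hadd
    _ ≤ (1 - t) • f a + t • f a := by gcongr
    _ = f a := by rw [← add_smul, hadd, one_smul]

theorem exists_isMinOn_of_forall_sphere_lt [ProperSpace E] {f : E → ℝ≥0∞}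
    (hf : ConvexOn ℝ≥0 Set.univ f) (hlsc : LowerSemicontinuous f) {a : E} {r : ℝ} (hr : 0 < r)
    (h : ∀ y ∈ Metric.sphere a r, f a < f y) : ∃ b, IsMinOn f Set.univ b := by
  have ha : a ∈ Metric.closedBall a r := Metric.mem_closedBall_self hr.le
  obtain ⟨b, -, hmin⟩ := LowerSemicontinuousOn.exists_isMinOn ⟨a, ha⟩ (isCompact_closedBall a r)
    (hlsc.lowerSemicontinuousOn _)
  refine ⟨b, fun y _ => ?_⟩
  rcases le_total ‖y - a‖ r with hy | hy
  · exact hmin (mem_closedBall_iff_norm.2 hy)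
  · exact (hmin ha).trans (lt_of_forall_sphere_lt hf hr h hy).le

theorem convexOn_ofReal {g : E → ℝ} (hg : ConvexOn ℝ Set.univ g) :
    ConvexOn ℝ≥0 Set.univ fun x => ENNReal.ofReal (g x) := by
  refine ⟨convex_univ, fun x _ y _ s t _ _ hst => ?_⟩
  have hst' : (s : ℝ) + t = 1 := by exact_mod_cast hst
  calc ENNReal.ofReal (g (s • x + t • y))
      ≤ ENNReal.ofReal (s * g x + t * g y) :=
        ENNReal.ofReal_le_ofReal (hg.2 trivial trivial s.2 t.2 hst')
    _ ≤ ENNReal.ofReal (s * g x) + ENNReal.ofReal (t * g y) := ENNReal.ofReal_add_le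
    _ = s • ENNReal.ofReal (g x) + t • ENNReal.ofReal (g y) := by
        simp only [ENNReal.ofReal_mul (NNReal.coe_nonneg _), ENNReal.ofReal_coe_nnreal,
          ENNReal.smul_def, smul_eq_mul]

theorem convexOn_const_mul {f : E → ℝ≥0∞} (hf : ConvexOn ℝ≥0 Set.univ f) (c : ℝ≥0∞) :
    ConvexOn ℝ≥0 Set.univ fun x => c * f x := by
  refine ⟨convex_univ, fun x hx y hy s t hs ht hst => ?_⟩
  calc c * f (s • x + t • y) ≤ c * (s • f x + t • f y) := by gcongr; exact hf.2 hx hy hs ht hst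
    _ = s • (c * f x) + t • (c * f y) := by simp only [mul_add, mul_smul_comm]

theorem lowerSemicontinuous_const_mul {X : Type*} [TopologicalSpace X] {f : X → ℝ≥0∞}
    (hf : Continuous f) (c : ℝ≥0∞) : LowerSemicontinuous fun x => c * f x := by
  rcases eq_or_ne c ⊤ with rfl | hc
  · have : (fun x => ⊤ * f x) = (f ⁻¹' {0}ᶜ).indicator fun _ => ⊤ := by
      ext x
      by_cases hx : f x = 0 <;> simp [hx, ENNReal.top_mul]
    rw [this]
    exact (isOpen_compl_singleton.preimage hf).lowerSemicontinuous_indicator zero_le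
  · exact ((ENNReal.continuous_const_mul hc).comp hf).lowerSemicontinuous

variable [Fintype κ]

/-- The criterion of an `ℓ¹`-penalized estimation problem: the loss `L` plus a weighted sum of the
absolute values of the linear functionals `d k`. It takes values in `[0, ∞]`, so that an infinite
weight `w k` imposes the constraint `d k β = 0`. -/
noncomputable def penalized (L : E → ℝ) (w : κ → ℝ≥0∞) (d : κ → E →L[ℝ] ℝ) (β : E) : ℝ≥0∞ :=
  ENNReal.ofReal (L β) + ∑ k, w k * ENNReal.ofReal |d k β|

variable {L : E → ℝ} {w : κ → ℝ≥0∞} {d : κ → E →L[ℝ] ℝ}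

theorem convexOn_penalized (hL : ConvexOn ℝ Set.univ L) :
    ConvexOn ℝ≥0 Set.univ (penalized L w d) := by
  refine (convexOn_ofReal hL).add ?_
  have hterm : ∀ k, ConvexOn ℝ≥0 Set.univ fun β => w k * ENNReal.ofReal |d k β| := fun k =>
    convexOn_const_mul
      (convexOn_ofReal (convexOn_univ_norm.comp_linearMap (d k).toLinearMap)) _
  simpa only [Finset.sum_fn] using Finset.sum_induction _ (ConvexOn ℝ≥0 Set.univ)
    (fun _ _ => ConvexOn.add) (convexOn_const 0 convex_univ) fun k _ => hterm k

theorem lowerSemicontinuous_penalized (hL : Continuous L) :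
    LowerSemicontinuous (penalized L w d) :=
  (ENNReal.continuous_ofReal.comp hL).lowerSemicontinuous.add <|
    lowerSemicontinuous_sum fun k _ => lowerSemicontinuous_const_mul
      (ENNReal.continuous_ofReal.comp (d k).continuous.abs) (w k)

variable [DecidableEq κ] {T : Finset κ}

theorem le_penalized {A : ℝ} (hA : 0 ≤ A) (hwT : ∀ k ∈ T, ENNReal.ofReal A ≤ w k) (β : E) :
    ENNReal.ofReal (L β + A * ∑ k ∈ T, |d k β|) + ∑ k ∈ Tᶜ, w k * ENNReal.ofReal |d k β|
      ≤ penalized L w d β := by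
  rw [penalized, ← Finset.sum_add_sum_compl T, ← add_assoc, Finset.mul_sum]
  gcongr
  refine ENNReal.ofReal_add_le.trans ?_
  gcongr
  rw [ENNReal.ofReal_sum_of_nonneg fun k _ => by positivity]
  gcongr with k hk
  rw [ENNReal.ofReal_mul hA]
  gcongr
  exact hwT k hk

theorem penalized_le {b : ℝ} {β₀ : E} (hL₀ : 0 ≤ L β₀) (hb : 0 ≤ b) (hT : ∀ k ∈ T, d k β₀ = 0)
    (hwF : ∀ k ∈ Tᶜ, w k ≤ ENNReal.ofReal b) (β : E) :
    penalized L w d β₀ ≤ ENNReal.ofReal (L β₀ + b * ∑ k ∈ Tᶜ, |d k (β₀ - β)|)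
      + ∑ k ∈ Tᶜ, w k * ENNReal.ofReal |d k β| := by
  rw [penalized, ← Finset.sum_add_sum_compl T, Finset.sum_eq_zero fun k hk => by simp [hT k hk],
    zero_add, ENNReal.ofReal_add hL₀ (by positivity), add_assoc, Finset.mul_sum,
    ENNReal.ofReal_sum_of_nonneg fun k _ => by positivity, ← Finset.sum_add_distrib]
  gcongr with k hk
  have habs : |d k β₀| ≤ |d k (β₀ - β)| + |d k β| := by
    simpa using abs_add_le (d k (β₀ - β)) (d k β)
  calc w k * ENNReal.ofReal |d k β₀|
      ≤ w k * (ENNReal.ofReal |d k (β₀ - β)| + ENNReal.ofReal |d k β|) := by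
        rw [← ENNReal.ofReal_add (abs_nonneg _) (abs_nonneg _)]
        gcongr
    _ ≤ _ := by
        rw [mul_add, ENNReal.ofReal_mul hb]
        gcongr
        exact hwF k hk

theorem penalized_lt_penalized {A b : ℝ} {β₀ β : E} (hL₀ : 0 ≤ L β₀) (hA : 0 ≤ A) (hb : 0 ≤ b)
    (hT : ∀ k ∈ T, d k β₀ = 0) (hwT : ∀ k ∈ T, ENNReal.ofReal A ≤ w k)
    (hwF : ∀ k ∈ Tᶜ, w k ≤ ENNReal.ofReal b)
    (h : L β₀ + b * ∑ k ∈ Tᶜ, |d k (β₀ - β)| < L β + A * ∑ k ∈ T, |d k β|) :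
    penalized L w d β₀ < penalized L w d β := by
  have hfin : ∑ k ∈ Tᶜ, w k * ENNReal.ofReal |d k β| ≠ ⊤ :=
    (ENNReal.sum_lt_top.2 fun k hk => ENNReal.mul_lt_top
      ((hwF k hk).trans_lt ENNReal.ofReal_lt_top) ENNReal.ofReal_lt_top).ne
  refine (penalized_le hL₀ hb hT hwF β).trans_lt (lt_of_lt_of_le ?_ (le_penalized hA hwT β))
  exact ENNReal.add_lt_add_right hfin
    ((ENNReal.ofReal_lt_ofReal_iff_of_nonneg (by positivity)).2 h)

theorem penalized_lt_penalized_rescaled (hpos : ∀ β, 0 ≤ L β) {α v z : E} {s a t : ℝ}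
    (hs : 0 < s) (ha : 0 ≤ a) (ht : 0 ≤ t) (hα : ∀ k ∈ T, d k α = 0) (hv : ∀ k ∈ T, d k v = 0)
    (hwT : ∀ k ∈ T, ENNReal.ofReal (a * s) ≤ w k) (hwF : ∀ k ∈ Tᶜ, w k ≤ ENNReal.ofReal (t * s))
    (h : L (α + s⁻¹ • v) + t * ∑ k ∈ Tᶜ, |d k z|
      < L (α + s⁻¹ • (v + z)) + a * ∑ k ∈ T, |d k z|) :
    penalized L w d (α + s⁻¹ • v) < penalized L w d (α + s⁻¹ • (v + z)) := by
  refine penalized_lt_penalized (hpos _) (by positivity) (by positivity)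
    (fun k hk => by simp [hα k hk, hv k hk]) hwT hwF ?_
  have hscale : ∀ k, s * |d k (s⁻¹ • z)| = |d k z| := fun k => by
    rw [map_smul, smul_eq_mul, abs_mul, abs_of_pos (inv_pos.2 hs), mul_inv_cancel_left₀ hs.ne']
  have hsub : ∀ k, |d k (α + s⁻¹ • v - (α + s⁻¹ • (v + z)))| = |d k (s⁻¹ • z)| := fun k => by
    rw [show α + s⁻¹ • v - (α + s⁻¹ • (v + z)) = -(s⁻¹ • z) by module, map_neg, abs_neg]
  have hfused : ∀ k ∈ T, |d k (α + s⁻¹ • (v + z))| = |d k (s⁻¹ • z)| := fun k hk => by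
    simp [hα k hk, hv k hk]
  rw [Finset.sum_congr rfl hfused]
  simpa only [hsub, mul_assoc, Finset.mul_sum, hscale] using h

theorem exists_isMinOn_penalized_and_norm_sub_lt [ProperSpace E] (hconv : ConvexOn ℝ Set.univ L)
    (hcont : Continuous L) (hpos : ∀ β, 0 ≤ L β) {α v : E} {s δ a t : ℝ} (hs : 0 < s)
    (hδ : 0 < δ) (ha : 0 ≤ a) (ht : 0 ≤ t) (hα : ∀ k ∈ T, d k α = 0) (hv : ∀ k ∈ T, d k v = 0)
    (hwT : ∀ k ∈ T, ENNReal.ofReal (a * s) ≤ w k) (hwF : ∀ k ∈ Tᶜ, w k ≤ ENNReal.ofReal (t * s))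
    (h : ∀ z, ‖z‖ = δ → L (α + s⁻¹ • v) + t * ∑ k ∈ Tᶜ, |d k z|
      < L (α + s⁻¹ • (v + z)) + a * ∑ k ∈ T, |d k z|) :
    (∃ β, IsMinOn (penalized L w d) Set.univ β) ∧
      ∀ β, IsMinOn (penalized L w d) Set.univ β → ‖s • (β - α) - v‖ < δ := by
  have hrescale : ∀ y, s * ‖y - (α + s⁻¹ • v)‖ = ‖s • (y - α) - v‖ := fun y => by
    rw [← norm_smul_of_nonneg hs.le, ← sub_sub, smul_sub, smul_inv_smul₀ hs.ne']
  have hsphere : ∀ y ∈ Metric.sphere (α + s⁻¹ • v) (δ / s),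
      penalized L w d (α + s⁻¹ • v) < penalized L w d y := fun y hy => by
    have hz : ‖s • (y - α) - v‖ = δ := by
      rw [← hrescale, mem_sphere_iff_norm.1 hy, mul_div_cancel₀ _ hs.ne']
    have hlt := penalized_lt_penalized_rescaled hpos hs ha ht hα hv hwT hwF (h _ hz)
    rwa [add_sub_cancel, inv_smul_smul₀ hs.ne', add_sub_cancel] at hlt
  have hc := convexOn_penalized (w := w) (d := d) hconv
  refine ⟨exists_isMinOn_of_forall_sphere_lt hc (lowerSemicontinuous_penalized hcont)
    (by positivity) hsphere, fun β hβ => ?_⟩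
  by_contra! hle
  refine (lt_of_forall_sphere_lt hc (by positivity) hsphere (b := β) ?_).not_ge (hβ trivial)
  rwa [div_le_iff₀' hs, hrescale]

theorem eq_zero_of_isMinOn_penalized (hpos : ∀ β, 0 ≤ L β) {β β' : E} {A B b : ℝ}
    (hβ : IsMinOn (penalized L w d) Set.univ β) (hA : 0 ≤ A) (hb : 0 ≤ b) (hBA : B < A)
    (hT : ∀ k ∈ T, d k β' = 0) (hF : ∀ k ∈ Tᶜ, d k β' = d k β)
    (hwT : ∀ k ∈ T, ENNReal.ofReal A ≤ w k) (hwF : ∀ k ∈ Tᶜ, w k ≤ ENNReal.ofReal b)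
    (hL : L β' ≤ L β + B * ∑ k ∈ T, |d k β|) : ∀ k ∈ T, d k β = 0 := by
  by_contra! hne
  obtain ⟨k, hk, hne⟩ := hne
  have hsum : 0 < ∑ k ∈ T, |d k β| :=
    Finset.sum_pos' (fun _ _ => abs_nonneg _) ⟨k, hk, abs_pos.2 hne⟩
  refine (penalized_lt_penalized (hpos β') hA hb hT hwT hwF ?_).not_ge (hβ trivial)
  rw [Finset.sum_eq_zero fun k hk => by rw [map_sub, hF k hk, sub_self, abs_zero]]
  nlinarith

end Penalized

section Model

variable {p₀ p₁ : ℕ} {J₀₀ J₁₀ : Finset (Fin p₀)} {J₁₁ : Finset (Fin p₁)}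

/-- The functional `α ↦ α₁₀ₖ - α₀₀ₖ`, whose absolute value is penalized by the fused LASSO. -/
noncomputable def gap (k : ↥(J₀₀ ∩ J₁₀)) : (Coef J₀₀ J₁₀ J₁₁ → ℝ) →L[ℝ] ℝ :=
  .proj (R := ℝ) (φ := fun _ => ℝ) (common1 k) - .proj (R := ℝ) (φ := fun _ => ℝ) (common0 k)

theorem gap_apply (k : ↥(J₀₀ ∩ J₁₀)) (α : Coef J₀₀ J₁₀ J₁₁ → ℝ) :
    gap k α = α (common1 k) - α (common0 k) := rfl

theorem gap_eq_zero_iff {k : ↥(J₀₀ ∩ J₁₀)} {α : Coef J₀₀ J₁₀ J₁₁ → ℝ} :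
    gap k α = 0 ↔ α (common1 k) = α (common0 k) := sub_eq_zero

theorem abs_gap_le (k : ↥(J₀₀ ∩ J₁₀)) (u : Coef J₀₀ J₁₀ J₁₁ → ℝ) : |gap k u| ≤ 2 * ‖u‖ := by
  have h := abs_sub (u (common1 k)) (u (common0 k))
  have h₁ := norm_le_pi_norm u (common1 k)
  have h₀ := norm_le_pi_norm u (common0 k)
  rw [Real.norm_eq_abs] at h₀ h₁
  rw [gap_apply]
  linarith

/-- The weight of `|gap k|` in the adaptive fused LASSO criterion. As in `fusionPenalty`, it is
infinite if the initial estimates coincide and `lam` is positive. -/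
noncomputable def fusionWeight (lam γ : ℝ) (αinit : Coef J₀₀ J₁₀ J₁₁ → ℝ)
    (k : ↥(J₀₀ ∩ J₁₀)) : ℝ≥0∞ :=
  ENNReal.ofReal lam / ENNReal.ofReal (|gap k αinit| ^ γ)

theorem criterion_eq_penalized (lam γ : ℝ) (n : ℕ) (x : ℕ → Obs p₀ p₁)
    (αinit : Coef J₀₀ J₁₀ J₁₁ → ℝ) : criterion lam γ n x αinit
      = penalized (negLogLik n x) (fusionWeight lam γ αinit) gap := by
  ext α
  simp only [criterion, fusionPenalty, penalized, fusionWeight, gap_apply, Finset.mul_sum,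
    div_eq_mul_inv]
  congr! 2
  ring

theorem isMinimizer_iff {lam γ : ℝ} {n : ℕ} {x : ℕ → Obs p₀ p₁} {αinit α : Coef J₀₀ J₁₀ J₁₁ → ℝ} :
    IsMinimizer lam γ n x αinit α
      ↔ IsMinOn (penalized (negLogLik n x) (fusionWeight lam γ αinit) gap) Set.univ α := by
  rw [isMinOn_univ_iff, ← criterion_eq_penalized, IsMinimizer]

/-- The negative log-likelihood of one record, written through `softplus`. -/
noncomputable def recordLoss (o : Obs p₀ p₁) (α : Coef J₀₀ J₁₀ J₁₁ → ℝ) : ℝ :=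
  ∑ τ : Fin 2, (softplus (α ⬝ᵥ design τ o) - trt τ o * (α ⬝ᵥ design τ o))

theorem negLogLik_eq_sum_recordLoss (n : ℕ) (x : ℕ → Obs p₀ p₁) :
    negLogLik (J₀₀ := J₀₀) (J₁₀ := J₁₀) (J₁₁ := J₁₁) n x
      = ∑ i ∈ Finset.range n, recordLoss (x i) := by
  ext α
  simp only [negLogLik, Finset.sum_apply, recordLoss]
  rw [Finset.sum_comm]
  refine Finset.sum_congr rfl fun i _ => Finset.sum_congr rfl fun τ _ => ?_
  rw [prob, log_sigmoid, log_one_sub_sigmoid, dotProduct]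
  ring

theorem continuous_negLogLik (n : ℕ) (x : ℕ → Obs p₀ p₁) :
    Continuous (negLogLik (J₀₀ := J₀₀) (J₁₀ := J₁₀) (J₁₁ := J₁₁) n x) := by
  have hsoft : Continuous softplus := contDiff_softplus (n := 0).continuous
  simp only [negLogLik_eq_sum_recordLoss, Finset.sum_fn, recordLoss, dotProduct]
  fun_prop

theorem convexOn_recordLoss (o : Obs p₀ p₁) :
    ConvexOn ℝ Set.univ (recordLoss (J₀₀ := J₀₀) (J₁₀ := J₁₀) (J₁₁ := J₁₁) o) := by
  refine ⟨convex_univ, fun α _ β _ s t hs ht hst => ?_⟩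
  simp only [recordLoss, smul_eq_mul, Finset.mul_sum, ← Finset.sum_add_distrib, add_dotProduct,
    smul_dotProduct]
  gcongr with τ
  have hsoft := convexOn_softplus.2 (Set.mem_univ (α ⬝ᵥ design τ o))
    (Set.mem_univ (β ⬝ᵥ design τ o)) hs ht hst
  simp only [smul_eq_mul] at hsoft
  linear_combination hsoft

theorem convexOn_negLogLik (n : ℕ) (x : ℕ → Obs p₀ p₁) :
    ConvexOn ℝ Set.univ (negLogLik (J₀₀ := J₀₀) (J₁₀ := J₁₀) (J₁₁ := J₁₁) n x) := by
  rw [negLogLik_eq_sum_recordLoss]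
  exact Finset.sum_induction _ (ConvexOn ℝ Set.univ) (fun _ _ => ConvexOn.add)
    (convexOn_const 0 convex_univ) fun i _ => convexOn_recordLoss (x i)

end Model

section Graph

variable {p₀ p₁ : ℕ} {J₀₀ J₁₀ : Finset (Fin p₀)} {J₁₁ : Finset (Fin p₁)}

open Classical in
/-- The covariates `k` whose edge belongs to the graph `𝓑` of `α`. -/
noncomputable def fused (α : Coef J₀₀ J₁₀ J₁₁ → ℝ) : Finset ↥(J₀₀ ∩ J₁₀) := {k | gap k α = 0}

theorem mem_fused {α : Coef J₀₀ J₁₀ J₁₁ → ℝ} {k : ↥(J₀₀ ∩ J₁₀)} :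
    k ∈ fused α ↔ gap k α = 0 := by
  simp [fused]

theorem collapse_common1_of_mem {α : Coef J₀₀ J₁₀ J₁₁ → ℝ} {k : ↥(J₀₀ ∩ J₁₀)}
    (h : k ∈ fused α) : collapse α (common1 k) = common0 k := by
  have hk : (k : Fin p₀) ∈ J₀₀ := (Finset.mem_inter.1 k.2).1
  have he := (gap_eq_zero_iff.1 (mem_fused.1 h)).symm
  simp only [common0, common1] at he
  simp only [collapse, common0, common1, hk, dite_true, he, if_true]

theorem collapse_common1_of_notMem {α : Coef J₀₀ J₁₀ J₁₁ → ℝ} {k : ↥(J₀₀ ∩ J₁₀)}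
    (h : k ∉ fused α) : collapse α (common1 k) = common1 k := by
  have hk : (k : Fin p₀) ∈ J₀₀ := (Finset.mem_inter.1 k.2).1
  have he := mt gap_eq_zero_iff.2 (mt mem_fused.2 h)
  simp only [common0, common1] at he
  simp only [collapse, common1, hk, dite_true, Ne.symm he, if_false]

theorem collapse_eq_self_or (α : Coef J₀₀ J₁₀ J₁₁ → ℝ) (c : Coef J₀₀ J₁₀ J₁₁) :
    collapse α c = c ∨ ∃ k ∈ fused α, c = common1 k ∧ collapse α c = common0 k := by
  cases c with
  | base1 k =>
    by_cases h : (k : Fin p₀) ∈ J₀₀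
    · let k' : ↥(J₀₀ ∩ J₁₀) := ⟨k, Finset.mem_inter.2 ⟨h, k.2⟩⟩
      by_cases hk : k' ∈ fused α
      · exact Or.inr ⟨k', hk, rfl, collapse_common1_of_mem hk⟩
      · exact Or.inl (collapse_common1_of_notMem hk)
    · exact Or.inl (by simp [collapse, h])
  | _ => exact Or.inl rfl

theorem collapse_collapse (α : Coef J₀₀ J₁₀ J₁₁ → ℝ) (c : Coef J₀₀ J₁₀ J₁₁) :
    collapse α (collapse α c) = collapse α c := by
  rcases collapse_eq_self_or α c with h | ⟨k, -, -, h⟩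
  · rw [h, h]
  · rw [h]; rfl

theorem isCovariate_collapse {α : Coef J₀₀ J₁₀ J₁₁ → ℝ} {c : Coef J₀₀ J₁₀ J₁₁}
    (hc : IsCovariate c) : IsCovariate (collapse α c) := by
  rcases collapse_eq_self_or α c with h | ⟨k, -, -, h⟩
  · rwa [h]
  · rw [h]; trivial

/-- The edge of the fusion graph that belongs to a common covariate. -/
def fusionEdge (k : ↥(J₀₀ ∩ J₁₀)) : Sym2 (Vertex J₀₀ J₁₀ J₁₁) :=
  s(⟨common0 k, trivial⟩, ⟨common1 k, trivial⟩)

theorem common0_ne_common1 (k l : ↥(J₀₀ ∩ J₁₀)) :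
    (common0 k : Coef J₀₀ J₁₀ J₁₁) ≠ common1 l := by
  simp [common0, common1]

theorem edgeSet_fusionGraph :
    (fusionGraph J₀₀ J₁₀ J₁₁).edgeSet = Set.range fusionEdge := by
  ext e
  induction e with
  | h u v =>
    have hne : ∀ k, u.1 = common0 k ∧ v.1 = common1 k ∨ v.1 = common0 k ∧ u.1 = common1 k →
        u ≠ v := by
      rintro k (⟨hu, hv⟩ | ⟨hv, hu⟩) rfl
      · exact common0_ne_common1 k k (hu.symm.trans hv)
      · exact common0_ne_common1 k k (hv.symm.trans hu)
    simp only [SimpleGraph.mem_edgeSet, fusionGraph, SimpleGraph.fromRel_adj, Set.mem_range,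
      fusionEdge, eq_comm (b := s(u, v)), Sym2.eq_iff, Subtype.ext_iff (a1 := u),
      Subtype.ext_iff (a1 := v), ← exists_or, and_comm (a := u.1 = common1 _)]
    exact ⟨fun h => h.2, fun ⟨k, hk⟩ => ⟨by simpa [Subtype.ext_iff] using hne k hk, k, hk⟩⟩

theorem fusedEdges_eq_image (α : Coef J₀₀ J₁₀ J₁₁ → ℝ) :
    fusedEdges α = fusionEdge '' fused α := by
  have hmem : ∀ k, (∀ u ∈ (fusionEdge k : Sym2 (Vertex J₀₀ J₁₀ J₁₁)), ∀ v ∈ fusionEdge k,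
      α u.1 = α v.1) ↔ k ∈ fused α := fun k => by
    simp only [fusionEdge, Sym2.mem_iff, mem_fused, gap_eq_zero_iff]
    aesop
  ext e
  simp only [fusedEdges, edgeSet_fusionGraph, Set.mem_ofPred_eq, Set.mem_image, Finset.mem_coe]
  constructor
  · rintro ⟨⟨k, rfl⟩, h⟩
    exact ⟨k, (hmem k).1 h, rfl⟩
  · rintro ⟨k, hk, rfl⟩
    exact ⟨⟨k, rfl⟩, (hmem k).2 hk⟩

theorem collapse_eq_of_adj {α : Coef J₀₀ J₁₀ J₁₁ → ℝ} {u v : Vertex J₀₀ J₁₀ J₁₁}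
    (h : (SimpleGraph.fromEdgeSet (fusedEdges α)).Adj u v) :
    collapse α u.1 = collapse α v.1 := by
  rw [SimpleGraph.fromEdgeSet_adj, fusedEdges_eq_image] at h
  obtain ⟨⟨k, hk, he⟩, -⟩ := h
  have h₁ : collapse α (common1 k) = common0 k := collapse_common1_of_mem hk
  have h₀ : collapse α (common0 k) = common0 k := rfl
  rw [fusionEdge, Sym2.eq_iff] at he
  rcases he with ⟨rfl, rfl⟩ | ⟨rfl, rfl⟩ <;> simp only [h₀, h₁]

theorem collapse_reachable (α : Coef J₀₀ J₁₀ J₁₁ → ℝ) (v : Vertex J₀₀ J₁₀ J₁₁) :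
    (SimpleGraph.fromEdgeSet (fusedEdges α)).Reachable
      ⟨collapse α v.1, isCovariate_collapse v.2⟩ v := by
  obtain ⟨c, hc⟩ := v
  rcases collapse_eq_self_or α c with h | ⟨k, hk, rfl, h⟩
  · simp only [h]; exact SimpleGraph.Reachable.refl _
  · refine SimpleGraph.Adj.reachable ?_
    rw [SimpleGraph.fromEdgeSet_adj, fusedEdges_eq_image]
    simp only [h]
    exact ⟨⟨k, hk, rfl⟩, fun e => common0_ne_common1 k k (congrArg Subtype.val e)⟩

/-- Each component of the graph of fused edges contains exactly one vertex that `collapse` fixes. -/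
noncomputable def componentEquiv (α : Coef J₀₀ J₁₀ J₁₁ → ℝ) :
    (SimpleGraph.fromEdgeSet (fusedEdges α)).ConnectedComponent ≃
      {r : Reduced α // IsCovariate r.1} where
  toFun C := C.lift
    (fun v => ⟨⟨collapse α v.1, collapse_collapse α v.1⟩, isCovariate_collapse v.2⟩)
    (fun u v w _ => by
      simp only [Subtype.mk.injEq]
      induction w with
      | nil => rfl
      | cons h w ih => exact (collapse_eq_of_adj h).trans (ih (by simp_all)))
  invFun r := SimpleGraph.connectedComponentMk _ ⟨r.1.1, r.2⟩
  left_inv C := by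
    induction C using SimpleGraph.ConnectedComponent.ind with
    | h v => exact SimpleGraph.ConnectedComponent.sound (collapse_reachable α v)
  right_inv r := by
    obtain ⟨⟨c, hc⟩, h⟩ := r
    simp [hc]

theorem card_reduced (α : Coef J₀₀ J₁₀ J₁₁ → ℝ) :
    Fintype.card (Reduced α) = numComponents α + 3 := by
  classical
  have h3 : Fintype.card {r : Reduced α // ¬ IsCovariate r.1} = 3 := by
    let f : Fin 3 → {r : Reduced α // ¬ IsCovariate r.1} := fun i =>
      match i with
      | 0 => ⟨⟨.icpt0, rfl⟩, id⟩
      | 1 => ⟨⟨.icpt1, rfl⟩, id⟩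
      | 2 => ⟨⟨.trt1, rfl⟩, id⟩
    have hf : Function.Bijective f := by
      constructor
      · intro i j h
        fin_cases i <;> fin_cases j <;> simp_all [f, Subtype.ext_iff]
      · rintro ⟨⟨c, hc⟩, h⟩
        cases c with
        | icpt0 => exact ⟨0, rfl⟩
        | icpt1 => exact ⟨1, rfl⟩
        | trt1 => exact ⟨2, rfl⟩
        | _ => exact absurd trivial h
    rw [← Fintype.card_of_bijective hf, Fintype.card_fin]
  rw [numComponents, Nat.card_congr (componentEquiv α), Nat.card_eq_fintype_card, ← h3,
    Fintype.card_subtype_compl]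
  have := Fintype.card_subtype_le (fun r : Reduced α => IsCovariate r.1)
  omega

theorem gap_comp_collapse_of_mem {α : Coef J₀₀ J₁₀ J₁₁ → ℝ} {k : ↥(J₀₀ ∩ J₁₀)}
    (hk : k ∈ fused α) (u : Coef J₀₀ J₁₀ J₁₁ → ℝ) : gap k (u ∘ collapse α) = 0 := by
  rw [gap_apply, Function.comp_apply, collapse_common1_of_mem hk]
  exact sub_self _

theorem gap_comp_collapse_of_notMem {α : Coef J₀₀ J₁₀ J₁₁ → ℝ} {k : ↥(J₀₀ ∩ J₁₀)}
    (hk : k ∉ fused α) (u : Coef J₀₀ J₁₀ J₁₁ → ℝ) : gap k (u ∘ collapse α) = gap k u := by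
  rw [gap_apply, Function.comp_apply, collapse_common1_of_notMem hk]
  rfl

theorem norm_comp_collapse_le (α u : Coef J₀₀ J₁₀ J₁₁ → ℝ) : ‖u ∘ collapse α‖ ≤ ‖u‖ :=
  (pi_norm_le_iff_of_nonneg (norm_nonneg _)).2 fun c => norm_le_pi_norm u (collapse α c)

theorem norm_comp_collapse_sub_le (α u : Coef J₀₀ J₁₀ J₁₁ → ℝ) :
    ‖u ∘ collapse α - u‖ ≤ ∑ k ∈ fused α, |gap k u| := by
  have hnn : ∀ k ∈ fused α, 0 ≤ |gap k u| := fun _ _ => abs_nonneg _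
  refine (pi_norm_le_iff_of_nonneg (Finset.sum_nonneg hnn)).2 fun c => ?_
  rcases collapse_eq_self_or α c with h | ⟨k, hk, rfl, h⟩
  · simpa [h] using Finset.sum_nonneg hnn
  · rw [Pi.sub_apply, Function.comp_apply, h, norm_sub_rev]
    exact Finset.single_le_sum (f := fun k => |gap k u|) hnn hk

theorem expandMatrix_mulVec (α : Coef J₀₀ J₁₀ J₁₁ → ℝ) (v : Reduced α → ℝ)
    (c : Coef J₀₀ J₁₀ J₁₁) :
    (expandMatrix α *ᵥ v) c = v ⟨collapse α c, collapse_collapse α c⟩ := by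
  classical
  have heq : ∀ r : Reduced α, collapse α c = r.1 ↔ ⟨collapse α c, collapse_collapse α c⟩ = r :=
    fun r => by rw [Subtype.ext_iff]
  simp [expandMatrix, Matrix.mulVec, dotProduct, heq]

theorem expandMatrix_mulVec_restrict (α u : Coef J₀₀ J₁₀ J₁₁ → ℝ) :
    expandMatrix α *ᵥ (fun r : Reduced α => u r.1) = u ∘ collapse α := by
  ext c; rw [expandMatrix_mulVec, Function.comp_apply]

theorem expandMatrix_mulVec_apply (α : Coef J₀₀ J₁₀ J₁₁ → ℝ) (v : Reduced α → ℝ)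
    (r : Reduced α) : (expandMatrix α *ᵥ v) r.1 = v r := by
  rw [expandMatrix_mulVec]; congr 1; exact Subtype.ext r.2

theorem expandMatrix_mulVec_injective (α : Coef J₀₀ J₁₀ J₁₁ → ℝ) :
    Function.Injective (expandMatrix α).mulVec := fun v w h => by
  ext r
  rw [← expandMatrix_mulVec_apply α v r, h, expandMatrix_mulVec_apply]

theorem gap_expandMatrix_mulVec {α : Coef J₀₀ J₁₀ J₁₁ → ℝ} {k : ↥(J₀₀ ∩ J₁₀)}
    (hk : k ∈ fused α) (v : Reduced α → ℝ) : gap k (expandMatrix α *ᵥ v) = 0 := by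
  rw [gap_eq_zero_iff, expandMatrix_mulVec, expandMatrix_mulVec]
  congr 1
  exact Subtype.ext (collapse_common1_of_mem hk)

end Graph

section ConditionalBernoulli

variable {Ω : Type*} {m mΩ : MeasurableSpace Ω} {P : Measure Ω} {A p X : Ω → ℝ}

theorem lintegral_condLExp_mul (hm : m ≤ mΩ) [SigmaFinite (P.trim hm)] {Y g : Ω → ℝ≥0∞}
    (hY : Measurable Y) (hg : Measurable[m] g) :
    ∫⁻ ω, P⁻[Y|m] ω * g ω ∂P = ∫⁻ ω, Y ω * g ω ∂P := by
  have hYm : Measurable (P⁻[Y|m]) := measurable_condLExp' m P Y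
  have htrim : (P.withDensity P⁻[Y|m]).trim hm = (P.withDensity Y).trim hm := by
    refine @Measure.ext _ m _ _ fun s hs => ?_
    rw [trim_measurableSet_eq hm hs, trim_measurableSet_eq hm hs, withDensity_apply _ (hm s hs),
      withDensity_apply _ (hm s hs), setLIntegral_condLExp hm P Y hs]
  have hg' : Measurable g := hg.mono hm le_rfl
  have h := congrArg (fun ν => ∫⁻ ω, g ω ∂ν) htrim
  simp only [lintegral_trim hm hg, lintegral_withDensity_eq_lintegral_mul P hYm hg',
    lintegral_withDensity_eq_lintegral_mul P hY hg', Pi.mul_apply] at h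
  exact h

/-- Conditionally on `m`, the variable `A` is Bernoulli with success probability `p`. The version
`p` of the conditional probability is required to be `m`-measurable and to take its values in
`[0, 1]` everywhere. -/
structure IsBernoulliGiven (m : MeasurableSpace Ω) {mΩ : MeasurableSpace Ω} (P : Measure Ω)
    (A p : Ω → ℝ) : Prop where
  le : m ≤ mΩ
  measurable : Measurable A
  eq_zero_or_one : ∀ ω, A ω = 0 ∨ A ω = 1
  condExp_eq : P[A | m] =ᵐ[P] p
  measurable_prob : Measurable[m] p
  prob_mem : ∀ ω, p ω ∈ Set.Icc 0 1

namespace IsBernoulliGiven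

theorem integrable [IsFiniteMeasure P] (h : IsBernoulliGiven m P A p) : Integrable A P :=
  Integrable.of_bound h.measurable.aestronglyMeasurable 1
    (ae_of_all _ fun ω => by rcases h.eq_zero_or_one ω with h | h <;> simp [h])

theorem integrable_prob (h : IsBernoulliGiven m P A p) : Integrable p P :=
  integrable_condExp.congr h.condExp_eq

theorem one_sub [IsFiniteMeasure P] (h : IsBernoulliGiven m P A p) :
    IsBernoulliGiven m P (1 - A) (1 - p) where
  le := h.le
  measurable := measurable_const.sub h.measurable
  eq_zero_or_one ω := by rcases h.eq_zero_or_one ω with h | h <;> simp [h]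
  condExp_eq := by
    have hone : P[(1 : Ω → ℝ) | m] = 1 := condExp_const h.le (1 : ℝ)
    filter_upwards [condExp_sub (integrable_const (1 : ℝ)) h.integrable m, h.condExp_eq]
      with ω hsub hω
    exact hsub.trans (congrArg₂ (· - ·) (congrFun hone ω) hω)
  measurable_prob := measurable_const.sub h.measurable_prob
  prob_mem ω := ⟨sub_nonneg.2 (h.prob_mem ω).2, sub_le_self 1 (h.prob_mem ω).1⟩

theorem lintegral_mul [IsFiniteMeasure P] (h : IsBernoulliGiven m P A p) {g : Ω → ℝ≥0∞}
    (hg : Measurable[m] g) :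
    ∫⁻ ω, ENNReal.ofReal (A ω) * g ω ∂P = ∫⁻ ω, ENNReal.ofReal (p ω) * g ω ∂P := by
  have hA0 : 0 ≤ᵐ[P] A :=
    ae_of_all _ fun ω => by rcases h.eq_zero_or_one ω with h | h <;> simp [h]
  rw [← lintegral_condLExp_mul h.le h.measurable.ennreal_ofReal hg]
  refine lintegral_congr_ae ?_
  filter_upwards [condLExp_ofReal m h.integrable hA0, h.condExp_eq] with ω h₁ h₂
  rw [h₁, h₂]

/-- Splitting according to `A = 1` or `A = 0` makes the squared residual linear in `A`. -/
theorem lintegral_residual_sq [IsFiniteMeasure P] (h : IsBernoulliGiven m P A p)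
    (hX : Measurable[m] X) :
    ∫⁻ ω, ENNReal.ofReal (((A ω - p ω) * X ω) ^ 2) ∂P
      = ∫⁻ ω, ENNReal.ofReal (p ω * (1 - p ω) * X ω ^ 2) ∂P := by
  let g₁ : Ω → ℝ≥0∞ := fun ω => ENNReal.ofReal ((1 - p ω) ^ 2 * X ω ^ 2)
  let g₀ : Ω → ℝ≥0∞ := fun ω => ENNReal.ofReal (p ω ^ 2 * X ω ^ 2)
  have hm₁ : Measurable[m] g₁ :=
    (((measurable_const.sub h.measurable_prob).pow_const 2).mul (hX.pow_const 2)).ennreal_ofReal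
  have hm₀ : Measurable[m] g₀ :=
    ((h.measurable_prob.pow_const 2).mul (hX.pow_const 2)).ennreal_ofReal
  have hA : Measurable fun ω => ENNReal.ofReal (A ω) * g₁ ω :=
    h.measurable.ennreal_ofReal.mul (hm₁.mono h.le le_rfl)
  have hp : Measurable fun ω => ENNReal.ofReal (p ω) * g₁ ω :=
    (h.measurable_prob.ennreal_ofReal.mul hm₁).mono h.le le_rfl
  calc ∫⁻ ω, ENNReal.ofReal (((A ω - p ω) * X ω) ^ 2) ∂P
      = ∫⁻ ω, (ENNReal.ofReal (A ω) * g₁ ω + ENNReal.ofReal ((1 - A) ω) * g₀ ω) ∂P := by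
        refine lintegral_congr fun ω => ?_
        rcases h.eq_zero_or_one ω with hA | hA <;> simp [g₀, g₁, hA, mul_pow]
    _ = ∫⁻ ω, (ENNReal.ofReal (p ω) * g₁ ω + ENNReal.ofReal ((1 - p) ω) * g₀ ω) ∂P := by
        rw [lintegral_add_left hA, lintegral_add_left hp, h.lintegral_mul hm₁,
          h.one_sub.lintegral_mul hm₀]
    _ = ∫⁻ ω, ENNReal.ofReal (p ω * (1 - p ω) * X ω ^ 2) ∂P := by
        refine lintegral_congr fun ω => ?_
        have hp₀ : 0 ≤ p ω := (h.prob_mem ω).1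
        have hp₁ : 0 ≤ 1 - p ω := sub_nonneg.2 (h.prob_mem ω).2
        rw [Pi.sub_apply, Pi.one_apply, ← ENNReal.ofReal_mul hp₀, ← ENNReal.ofReal_mul hp₁,
          ← ENNReal.ofReal_add (by positivity) (by positivity)]
        congr 1
        ring

theorem memLp_residual [IsFiniteMeasure P] (h : IsBernoulliGiven m P A p) (hX : Measurable[m] X)
    (hint : Integrable (fun ω => p ω * (1 - p ω) * X ω ^ 2) P) :
    MemLp (fun ω => (A ω - p ω) * X ω) 2 P := by
  have hmeas : Measurable fun ω => (A ω - p ω) * X ω :=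
    (h.measurable.sub (h.measurable_prob.mono h.le le_rfl)).mul (hX.mono h.le le_rfl)
  rw [memLp_two_iff_integrable_sq hmeas.aestronglyMeasurable]
  refine ⟨(hmeas.pow_const 2).aestronglyMeasurable, ?_⟩
  rw [hasFiniteIntegral_iff_ofReal (ae_of_all _ fun ω => sq_nonneg _), h.lintegral_residual_sq hX]
  exact hint.lintegral_lt_top

theorem integral_residual [IsFiniteMeasure P] (h : IsBernoulliGiven m P A p)
    (hX : Measurable[m] X) (hint : Integrable (fun ω => (A ω - p ω) * X ω) P) :
    ∫ ω, (A ω - p ω) * X ω ∂P = 0 := by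
  have hcentred : P[A - p | m] =ᵐ[P] 0 := by
    refine (condExp_sub h.integrable h.integrable_prob m).trans ?_
    rw [condExp_of_stronglyMeasurable h.le h.measurable_prob.stronglyMeasurable h.integrable_prob]
    filter_upwards [h.condExp_eq] with ω hω
    simp [hω]
  rw [← integral_condExp h.le]
  refine (integral_congr_ae ?_).trans (integral_zero Ω ℝ)
  filter_upwards [condExp_mul_of_stronglyMeasurable_right hX.stronglyMeasurable hint
    (h.integrable.sub h.integrable_prob), hcentred] with ω hmul hω
  exact hmul.trans (mul_eq_zero_of_left hω _)

end IsBernoulliGiven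

end ConditionalBernoulli

section Score

variable {p₀ p₁ : ℕ} {J₀₀ J₁₀ : Finset (Fin p₀)} {J₁₁ : Finset (Fin p₁)}
  {P : Measure (Obs p₀ p₁)} {α : Coef J₀₀ J₁₀ J₁₁ → ℝ}

theorem trt_eq_zero_or_one (τ : Fin 2) (o : Obs p₀ p₁) : trt τ o = 0 ∨ trt τ o = 1 := by
  unfold trt; split <;> split_ifs <;> simp

theorem measurable_trt (τ : Fin 2) : Measurable (trt τ : Obs p₀ p₁ → ℝ) := by
  have hb : Measurable fun b : Bool => if b then (1 : ℝ) else 0 := measurable_of_finite _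
  fin_cases τ
  · exact hb.comp (measurable_fst.comp measurable_snd)
  · exact hb.comp (measurable_snd.comp (measurable_snd.comp measurable_snd))

/-- The `σ`-algebra generated by the variables on which the model for `A_τ` conditions. -/
abbrev history (J₀₀ J₁₀ : Finset (Fin p₀)) (J₁₁ : Finset (Fin p₁)) (τ : Fin 2) :
    MeasurableSpace (Obs p₀ p₁) :=
  match τ with
  | 0 => MeasurableSpace.comap (fun (o : Obs p₀ p₁) (k : J₀₀) => o.1 k) inferInstance
  | 1 => MeasurableSpace.comap
      (fun o : Obs p₀ p₁ => (o.2.1, (fun k : J₁₀ => o.1 k), fun k : J₁₁ => o.2.2.1 k))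
      inferInstance

theorem history_le (τ : Fin 2) :
    history J₀₀ J₁₀ J₁₁ τ ≤ (inferInstance : MeasurableSpace (Obs p₀ p₁)) := by
  fin_cases τ
  · exact Measurable.comap_le (by fun_prop)
  · exact Measurable.comap_le (by fun_prop)

theorem measurable_history_design (τ : Fin 2) (c : Coef J₀₀ J₁₀ J₁₁) :
    Measurable[history J₀₀ J₁₀ J₁₁ τ] fun o : Obs p₀ p₁ => design τ o c := by
  have hb : Measurable fun b : Bool => if b then (1 : ℝ) else 0 := measurable_of_finite _
  fin_cases τ
  · have h := comap_measurable (m := MeasurableSpace.pi)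
      fun (o : Obs p₀ p₁) (k : J₀₀) => o.1 k
    cases c with
    | base0 k => exact (measurable_pi_apply k).comp h
    | _ => exact measurable_const
  · have h := comap_measurable (m := Prod.instMeasurableSpace) fun o : Obs p₀ p₁ =>
      (o.2.1, (fun k : J₁₀ => o.1 k), fun k : J₁₁ => o.2.2.1 k)
    cases c with
    | base1 k => exact (measurable_pi_apply k).comp ((measurable_fst.comp measurable_snd).comp h)
    | cov1 k => exact (measurable_pi_apply k).comp ((measurable_snd.comp measurable_snd).comp h)
    | trt1 =>
      have hf : Measurable fun y : Bool × (J₁₀ → ℝ) × (J₁₁ → ℝ) => if y.1 then (1 : ℝ) else 0 :=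
        hb.comp measurable_fst
      exact hf.comp h
    | _ => exact measurable_const

theorem measurable_history_prob (τ : Fin 2) (α : Coef J₀₀ J₁₀ J₁₁ → ℝ) :
    Measurable[history J₀₀ J₁₀ J₁₁ τ] fun o : Obs p₀ p₁ => prob τ o α := by
  refine continuous_sigmoid.measurable.comp ?_
  exact Finset.measurable_sum _ fun c _ => (measurable_history_design τ c).const_mul _

theorem CorrectModel.isBernoulliGiven (h : CorrectModel P α) (τ : Fin 2) :
    IsBernoulliGiven (history J₀₀ J₁₀ J₁₁ τ) P (trt τ) (fun o => prob τ o α) where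
  le := history_le τ
  measurable := measurable_trt τ
  eq_zero_or_one := trt_eq_zero_or_one τ
  condExp_eq := by
    fin_cases τ
    · exact h.1
    · exact h.2
  measurable_prob := measurable_history_prob τ α
  prob_mem _ := ⟨Real.sigmoid_nonneg _, Real.sigmoid_le_one _⟩

theorem measurable_score (α : Coef J₀₀ J₁₀ J₁₁ → ℝ) (c : Coef J₀₀ J₁₀ J₁₁) :
    Measurable fun o : Obs p₀ p₁ => score o α c :=
  Finset.measurable_sum _ fun τ _ =>
    ((measurable_trt τ).sub ((measurable_history_prob τ α).mono (history_le τ) le_rfl)).mul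
      ((measurable_history_design τ c).mono (history_le τ) le_rfl)

theorem memLp_residual_design [IsFiniteMeasure P] (hmodel : CorrectModel P α)
    (hfisher : FisherRegular P α) (τ : Fin 2) (c : Coef J₀₀ J₁₀ J₁₁) :
    MemLp (fun o => (trt τ o - prob τ o α) * design τ o c) 2 P :=
  (hmodel.isBernoulliGiven τ).memLp_residual (measurable_history_design τ c)
    ((hfisher.1 τ c c).congr (ae_of_all _ fun o => by ring))

theorem memLp_score [IsFiniteMeasure P] (hmodel : CorrectModel P α) (hfisher : FisherRegular P α)
    (c : Coef J₀₀ J₁₀ J₁₁) : MemLp (fun o => score o α c) 2 P :=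
  memLp_finsetSum _ fun τ _ => memLp_residual_design hmodel hfisher τ c

theorem integral_score [IsFiniteMeasure P] (hmodel : CorrectModel P α)
    (hfisher : FisherRegular P α) (c : Coef J₀₀ J₁₀ J₁₁) : ∫ o, score o α c ∂P = 0 := by
  have hint : ∀ τ, Integrable (fun o => (trt τ o - prob τ o α) * design τ o c) P := fun τ =>
    (memLp_residual_design hmodel hfisher τ c).integrable one_le_two
  unfold score
  rw [integral_finsetSum _ fun τ _ => hint τ]
  exact Finset.sum_eq_zero fun τ _ => (hmodel.isBernoulliGiven τ).integral_residual
    (measurable_history_design τ c) (hint τ)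

end Score

section CentralLimit

open scoped RealInnerProductSpace

variable {Ω Ω' : Type*} [MeasurableSpace Ω] [MeasurableSpace Ω'] {μ : Measure Ω} {ν : Measure Ω'}
  [IsProbabilityMeasure μ] {ι : Type*} [Fintype ι]

theorem charFun_map_eq_charFun_map_inner {E : Type*} [NormedAddCommGroup E]
    [InnerProductSpace ℝ E] [MeasurableSpace E] [BorelSpace E] {X : Ω' → E}
    (hX : AEMeasurable X ν) (t : E) :
    charFun (ν.map X) t = charFun (ν.map fun ω => ⟪t, X ω⟫) 1 := by
  have hg : AEMeasurable (fun ω => ⟪t, X ω⟫) ν :=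
    (continuous_const.inner continuous_id).measurable.comp_aemeasurable hX
  rw [charFun_apply, charFun_apply_real, integral_map hX (by fun_prop),
    integral_map hg (by fun_prop)]
  simp only [real_inner_comm, Complex.ofReal_one, one_mul]

theorem tendstoInDistribution_of_forall_inner [IsProbabilityMeasure ν] {E : Type*}
    [NormedAddCommGroup E] [InnerProductSpace ℝ E] [FiniteDimensional ℝ E] [MeasurableSpace E]
    [BorelSpace E] {X : ℕ → Ω → E} {Y : Ω' → E} (hX : ∀ n, AEMeasurable (X n) μ)
    (hY : AEMeasurable Y ν)
    (h : ∀ t, TendstoInDistribution (fun n ω => ⟪t, X n ω⟫) atTop (fun ω => ⟪t, Y ω⟫)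
      (fun _ => μ) ν) :
    TendstoInDistribution X atTop Y (fun _ => μ) ν := by
  refine ⟨hX, hY, ProbabilityMeasure.tendsto_of_tendsto_charFun fun t => ?_⟩
  have ht := ProbabilityMeasure.tendsto_iff_tendsto_charFun.1 (h t).tendsto 1
  simp only [ProbabilityMeasure.coe_mk] at ht ⊢
  simpa only [charFun_map_eq_charFun_map_inner (hX _),
    charFun_map_eq_charFun_map_inner hY] using ht

theorem hasLaw_inner_multivariateGaussian [DecidableEq ι] {S : Matrix ι ι ℝ}
    (hS : S.PosSemidef) (t : EuclideanSpace ℝ ι) :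
    HasLaw (fun x => ⟪t, x⟫) (gaussianReal 0 (t ⬝ᵥ S *ᵥ t).toNNReal)
      (multivariateGaussian 0 S) where
  map_eq := by
    have hmean : (multivariateGaussian 0 S)[innerSL ℝ t] = 0 := by
      rw [ContinuousLinearMap.integral_comp_id_comm IsGaussian.integrable_id,
        integral_id_multivariateGaussian, map_zero]
    have hvar : Var[innerSL ℝ t; multivariateGaussian 0 S] = t ⬝ᵥ S *ᵥ t := by
      rw [← covarianceBilin_multivariateGaussian (μ := 0) hS t t,
        covarianceBilin_self IsGaussian.memLp_two_id]
      rfl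
    change (multivariateGaussian 0 S).map (innerSL ℝ t) = _
    rw [IsGaussian.map_eq_gaussianReal, hmean, hvar]

theorem integral_sq_sum_mul {X : Ω' → ι → ℝ} (hX : ∀ a, MemLp (fun ω => X ω a) 2 ν) (t : ι → ℝ) :
    ∫ ω, (∑ a, t a * X ω a) ^ 2 ∂ν
      = t ⬝ᵥ (Matrix.of fun a b => ∫ ω, X ω a * X ω b ∂ν) *ᵥ t := by
  have hint : ∀ a b, Integrable (fun ω => t a * X ω a * (t b * X ω b)) ν := fun a b =>
    ((hX a).const_mul (t a)).integrable_mul ((hX b).const_mul (t b))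
  simp only [sq, Finset.sum_mul_sum]
  simp only [dotProduct, Matrix.mulVec, Matrix.of_apply, Finset.mul_sum]
  rw [integral_finsetSum _ fun a _ => integrable_finsetSum _ fun b _ => hint a b]
  refine Finset.sum_congr rfl fun a _ => ?_
  rw [integral_finsetSum _ fun b _ => hint a b]
  refine Finset.sum_congr rfl fun b _ => ?_
  simp only [mul_mul_mul_comm _ (X _ _), integral_const_mul]
  ring

theorem posSemidef_of_integral_mul {κ : Type*} [Finite κ] {X : Ω' → κ → ℝ}
    (hX : ∀ a, MemLp (fun ω => X ω a) 2 ν) :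
    (Matrix.of fun a b => ∫ ω, X ω a * X ω b ∂ν).PosSemidef := by
  have := Fintype.ofFinite κ
  refine Matrix.PosSemidef.of_dotProduct_mulVec_nonneg ?_ fun t => ?_
  · ext a b
    simp [Matrix.conjTranspose_apply, mul_comm]
  · rw [star_trivial, ← integral_sq_sum_mul hX]
    exact integral_nonneg fun ω => sq_nonneg _

theorem tendstoInDistribution_inv_sqrt_smul_sum [DecidableEq ι]
    {X : ℕ → Ω → EuclideanSpace ℝ ι} (hX : ∀ a, MemLp (fun ω => X 0 ω a) 2 μ)
    (hmean : ∀ a, ∫ ω, X 0 ω a ∂μ = 0) (hindep : iIndepFun X μ)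
    (hident : ∀ i, IdentDistrib (X i) (X 0) μ μ) :
    TendstoInDistribution (fun (n : ℕ) ω => (√(n : ℝ))⁻¹ • ∑ i ∈ Finset.range n, X i ω) atTop id
      (fun _ => μ)
      (multivariateGaussian 0 (Matrix.of fun a b => ∫ ω, X 0 ω a * X 0 ω b ∂μ)) := by
  have hmeas : ∀ i, AEMeasurable (X i) μ := fun i => (hident i).aemeasurable_fst
  refine tendstoInDistribution_of_forall_inner (fun n => by fun_prop) aemeasurable_id fun t => ?_
  have hinner : Measurable fun x : EuclideanSpace ℝ ι => ⟪t, x⟫ := by fun_prop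
  have hsum : ∀ ω, ⟪t, X 0 ω⟫ = ∑ a, t a * X 0 ω a := fun ω => by
    simp [PiLp.inner_apply, mul_comm]
  have hL2 : MemLp (fun ω => ⟪t, X 0 ω⟫) 2 μ := by
    simp only [hsum]
    exact memLp_finsetSum _ fun a _ => (hX a).const_mul _
  have hmean_inner : μ[fun ω => ⟪t, X 0 ω⟫] = 0 := by
    simp only [hsum]
    rw [integral_finsetSum _ fun a _ => ((hX a).integrable one_le_two).const_mul _]
    simp only [integral_const_mul, hmean, mul_zero, Finset.sum_const_zero]
  have hvar : Var[fun ω => ⟪t, X 0 ω⟫; μ]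
      = t ⬝ᵥ (Matrix.of fun a b => ∫ ω, X 0 ω a * X 0 ω b ∂μ) *ᵥ t := by
    rw [variance_of_integral_eq_zero hL2.aemeasurable hmean_inner]
    simpa only [Pi.pow_apply, hsum] using integral_sq_sum_mul hX t
  have hlaw := hasLaw_inner_multivariateGaussian (posSemidef_of_integral_mul hX) t
  rw [← hvar] at hlaw
  have hclt := tendstoInDistribution_inv_sqrt_mul_sum_sub (X := fun i ω => ⟪t, X i ω⟫) hlaw hL2
    (hindep.comp (fun _ x => ⟪t, x⟫) fun _ => hinner) fun i => (hident i).comp hinner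
  simpa only [hmean_inner, mul_zero, sub_zero, Function.comp_def, id_eq, inner_smul_right,
    inner_sum] using hclt

end CentralLimit

section BoundedInProbability

variable {Ω : Type*} [MeasurableSpace Ω] {μ : Measure Ω}

/-- The upper half of `Z_n = O_P(1)`, in the `ε`-`C` form of `IsSqrtConsistent`. -/
def BoundedAboveInProb (μ : Measure Ω) (Z : ℕ → Ω → ℝ) : Prop :=
  ∀ ε : ℝ≥0∞, 0 < ε → ∃ C : ℝ, ∀ᶠ n : ℕ in atTop, μ {ω | C < Z n ω} ≤ ε

namespace BoundedAboveInProb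

theorem add {Z W : ℕ → Ω → ℝ} (hZ : BoundedAboveInProb μ Z) (hW : BoundedAboveInProb μ W) :
    BoundedAboveInProb μ fun n ω => Z n ω + W n ω := by
  intro ε hε
  obtain ⟨C, hC⟩ := hZ (ε / 2) (ENNReal.half_pos hε.ne')
  obtain ⟨D, hD⟩ := hW (ε / 2) (ENNReal.half_pos hε.ne')
  refine ⟨C + D, ?_⟩
  filter_upwards [hC, hD] with n hCn hDn
  have hsub : {ω | C + D < Z n ω + W n ω} ⊆ {ω | C < Z n ω} ∪ {ω | D < W n ω} :=
    fun ω hω => by simpa using lt_or_lt_of_add_lt_add (by simpa using hω)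
  calc μ {ω | C + D < Z n ω + W n ω} ≤ μ {ω | C < Z n ω} + μ {ω | D < W n ω} :=
        (measure_mono hsub).trans (measure_union_le _ _)
    _ ≤ ε / 2 + ε / 2 := add_le_add hCn hDn
    _ = ε := ENNReal.add_halves ε

theorem sum {ι : Type*} (s : Finset ι) {Z : ι → ℕ → Ω → ℝ}
    (hZ : ∀ i, BoundedAboveInProb μ (Z i)) :
    BoundedAboveInProb μ fun n ω => ∑ i ∈ s, Z i n ω := by
  classical
  induction s using Finset.induction_on with
  | empty => exact fun ε _ => ⟨0, Eventually.of_forall fun n => by simp⟩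
  | insert i s hi ih =>
    simp only [Finset.sum_insert hi]
    exact (hZ i).add ih

theorem mono {Z W : ℕ → Ω → ℝ} (hW : BoundedAboveInProb μ W)
    (h : ∀ n ω, Z n ω ≤ W n ω) : BoundedAboveInProb μ Z := fun ε hε =>
  (hW ε hε).imp fun _C hC => hC.mono fun _n hn =>
    (measure_mono fun ω (hω : _ < Z _ ω) => hω.trans_le (h _ ω)).trans hn

theorem tendsto_measure_not_zero {Z : ℕ → Ω → ℝ}
    (hZ : BoundedAboveInProb μ Z) {good : ℕ → Ω → Prop}
    (h : ∀ K : ℝ, ∃ R : ℕ → Ω → ℝ, TendstoInMeasure μ R atTop 0 ∧ ∃ ρ : ℝ, 0 < ρ ∧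
      ∀ᶠ n in atTop, ∀ᵐ ω ∂μ, Z n ω ≤ K → R n ω ≤ ρ → good n ω) :
    Tendsto (fun n => μ {ω | ¬ good n ω}) atTop (𝓝 0) := by
  refine ENNReal.tendsto_nhds_zero.2 fun ε hε => ?_
  obtain ⟨K, hK⟩ := hZ (ε / 2) (ENNReal.half_pos hε.ne')
  obtain ⟨R, hR, ρ, hρ, hgood⟩ := h K
  filter_upwards [hK, hgood, ((tendstoInMeasure_iff_norm.1 hR) ρ hρ).eventually_le_const
    (ENNReal.half_pos hε.ne')] with n hKn hgood_n hRn
  calc μ {ω | ¬ good n ω} ≤ μ ({ω | K < Z n ω} ∪ {ω | ρ ≤ ‖R n ω - 0‖}) := by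
        refine measure_mono_ae ?_
        filter_upwards [hgood_n] with ω hω hbad
        by_contra hcon
        have hcon' : ¬ (K < Z n ω ∨ ρ ≤ ‖R n ω - 0‖) := hcon
        rw [not_or, not_lt, not_le, sub_zero, Real.norm_eq_abs] at hcon'
        exact hbad (hω hcon'.1 ((le_abs_self _).trans hcon'.2.le))
    _ ≤ ε / 2 + ε / 2 := (measure_union_le _ _).trans (add_le_add hKn hRn)
    _ = ε := ENNReal.add_halves ε

end BoundedAboveInProb

theorem variance_inv_sqrt_mul_sum {X : ℕ → Ω → ℝ} (hX : MemLp (X 0) 2 μ)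
    (hindep : iIndepFun X μ) (hident : ∀ i, IdentDistrib (X i) (X 0) μ μ) {n : ℕ} (hn : n ≠ 0) :
    Var[fun ω => (√(n : ℝ))⁻¹ * ∑ i ∈ Finset.range n, X i ω; μ] = Var[X 0; μ] := by
  have hsum : Var[fun ω => ∑ i ∈ Finset.range n, X i ω; μ] = n * Var[X 0; μ] := by
    have := IndepFun.variance_sum (s := Finset.range n)
      (fun i _ => (hident i).memLp_iff.2 hX) fun i _ j _ hij => hindep.indepFun hij
    simpa only [Finset.sum_fn, (hident _).variance_eq, Finset.sum_const, Finset.card_range,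
      nsmul_eq_mul] using this
  rw [variance_const_mul, hsum, inv_pow, Real.sq_sqrt n.cast_nonneg,
    inv_mul_cancel_left₀ (Nat.cast_ne_zero.2 hn)]

theorem boundedAboveInProb_abs_inv_sqrt_mul_sum [IsFiniteMeasure μ] {X : ℕ → Ω → ℝ}
    (hX : MemLp (X 0) 2 μ) (hmean : μ[X 0] = 0) (hindep : iIndepFun X μ)
    (hident : ∀ i, IdentDistrib (X i) (X 0) μ μ) :
    BoundedAboveInProb μ fun n ω => |(√(n : ℝ))⁻¹ * ∑ i ∈ Finset.range n, X i ω| := by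
  intro ε hε
  have hXi : ∀ i, MemLp (X i) 2 μ := fun i => (hident i).memLp_iff.2 hX
  have hlim : Tendsto (fun K : ℝ => ENNReal.ofReal (Var[X 0; μ] / K ^ 2)) atTop (𝓝 0) := by
    rw [← ENNReal.ofReal_zero]
    exact ENNReal.tendsto_ofReal (tendsto_const_nhds.div_atTop (tendsto_pow_atTop two_ne_zero))
  obtain ⟨K, hK, hK0⟩ := ((hlim.eventually_le_const hε).and (eventually_gt_atTop 0)).exists
  refine ⟨K, ?_⟩
  filter_upwards [eventually_ne_atTop 0] with n hn
  have hL2 : MemLp (fun ω => (√(n : ℝ))⁻¹ * ∑ i ∈ Finset.range n, X i ω) 2 μ :=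
    (memLp_finsetSum _ fun i _ => hXi i).const_mul _
  have hmean_n : μ[fun ω => (√(n : ℝ))⁻¹ * ∑ i ∈ Finset.range n, X i ω] = 0 := by
    rw [integral_const_mul, integral_finsetSum _ fun i _ => (hXi i).integrable one_le_two]
    simp [(hident _).integral_eq, hmean]
  have hchebyshev := meas_ge_le_variance_div_sq hL2 hK0
  rw [hmean_n, variance_inv_sqrt_mul_sum hX hindep hident hn] at hchebyshev
  simp only [sub_zero] at hchebyshev
  exact (measure_mono fun ω (hω : K < _) => hω.le).trans (hchebyshev.trans hK)

end BoundedInProbability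

section Averages

variable {Ω E : Type*} [MeasurableSpace Ω] [MeasurableSpace E] {μ : Measure Ω} {P : Measure E}
  {O : ℕ → Ω → E}

theorem identDistrib_comp_of_hasLaw {F : Type*} [MeasurableSpace F]
    (hlaw : ∀ i, HasLaw (O i) P μ) {g : E → F} (hg : AEMeasurable g P) (i j : ℕ) :
    IdentDistrib (g ∘ O i) (g ∘ O j) μ μ :=
  IdentDistrib.comp_of_aemeasurable
    ⟨(hlaw i).aemeasurable, (hlaw j).aemeasurable, by rw [(hlaw i).map_eq, (hlaw j).map_eq]⟩
    (by rwa [(hlaw i).map_eq])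

theorem ae_tendsto_average (hlaw : ∀ i, HasLaw (O i) P μ)
    (hindep : Pairwise fun i j => O i ⟂ᵢ[μ] O j) {g : E → ℝ} (hg : Integrable g P) :
    ∀ᵐ ω ∂μ, Tendsto (fun n : ℕ => (∑ i ∈ Finset.range n, g (O i ω)) / n) atTop
      (𝓝 (∫ o, g o ∂P)) := by
  have hmeas : ∀ i, AEMeasurable g (μ.map (O i)) := fun i => by
    rw [(hlaw i).map_eq]
    exact hg.aemeasurable
  have hint : Integrable (g ∘ O 0) μ := by
    rw [← (hlaw 0).map_eq] at hg
    exact hg.comp_aemeasurable (hlaw 0).aemeasurable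
  have hstrong := strong_law_ae_real (fun i => g ∘ O i) hint
    (fun i j hij => (hindep hij).comp₀ (hlaw i).aemeasurable (hlaw j).aemeasurable
      (hmeas i) (hmeas j))
    fun i => identDistrib_comp_of_hasLaw hlaw hg.aemeasurable i 0
  rwa [(hlaw 0).integral_comp hg.aestronglyMeasurable] at hstrong

theorem aestronglyMeasurable_average (hlaw : ∀ i, HasLaw (O i) P μ) {g : E → ℝ}
    (hg : AEStronglyMeasurable g P) (n : ℕ) :
    AEStronglyMeasurable (fun ω => (∑ i ∈ Finset.range n, g (O i ω)) / n) μ := by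
  have hcomp : ∀ i, AEStronglyMeasurable (fun ω => g (O i ω)) μ := fun i => by
    rw [← (hlaw i).map_eq] at hg
    exact hg.comp_aemeasurable (hlaw i).aemeasurable
  simp only [div_eq_mul_inv]
  exact (Finset.aestronglyMeasurable_fun_sum _ fun i _ => hcomp i).mul_const _

end Averages

section Expansion

theorem abs_dotProduct_le {ι : Type*} [Fintype ι] (u v : ι → ℝ) :
    |u ⬝ᵥ v| ≤ ‖u‖ * ∑ i, |v i| := by
  simp only [dotProduct, Finset.mul_sum]
  refine (Finset.abs_sum_le_sum_abs _ _).trans (Finset.sum_le_sum fun i _ => ?_)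
  rw [abs_mul]
  gcongr
  exact norm_le_pi_norm u i

theorem sum_abs_mulVec_le {ι κ : Type*} [Fintype ι] [Fintype κ] (A : Matrix ι κ ℝ) (u : κ → ℝ) :
    ∑ i, |(A *ᵥ u) i| ≤ ‖u‖ * ∑ i, ∑ j, |A i j| := by
  rw [Finset.mul_sum]
  refine Finset.sum_le_sum fun i _ => ?_
  rw [Matrix.mulVec, dotProduct_comm]
  exact abs_dotProduct_le u (A i)

theorem abs_dotProduct_mulVec_le {ι : Type*} [Fintype ι] (A : Matrix ι ι ℝ) (u : ι → ℝ) :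
    |u ⬝ᵥ A *ᵥ u| ≤ ‖u‖ ^ 2 * ∑ i, ∑ j, |A i j| := by
  calc |u ⬝ᵥ A *ᵥ u| ≤ ‖u‖ * ∑ i, |(A *ᵥ u) i| := abs_dotProduct_le u _
    _ ≤ ‖u‖ * (‖u‖ * ∑ i, ∑ j, |A i j|) := by
        gcongr
        exact sum_abs_mulVec_le A u
    _ = ‖u‖ ^ 2 * ∑ i, ∑ j, |A i j| := by ring

theorem add_smul_inv_smul_mem_ball {E : Type*} [NormedAddCommGroup E] [NormedSpace ℝ E] {α u : E}
    {s r C t : ℝ} (hs : 0 < s) (hu : ‖u‖ ≤ C) (hC : C < r * s) (ht : t ∈ Set.Icc 0 1) :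
    α + t • s⁻¹ • u ∈ Metric.ball α r := by
  rw [Metric.mem_ball, dist_eq_norm, add_sub_cancel_left, norm_smul, norm_smul,
    Real.norm_of_nonneg ht.1, Real.norm_of_nonneg (inv_pos.2 hs).le]
  calc t * (s⁻¹ * ‖u‖) ≤ 1 * (s⁻¹ * C) := by
        gcongr
        exact ht.2
    _ < r := by rwa [one_mul, inv_mul_lt_iff₀ hs, mul_comm]

variable {p₀ p₁ : ℕ} {J₀₀ J₁₀ : Finset (Fin p₀)} {J₁₁ : Finset (Fin p₁)}

/-- The contribution `∑_τ m_τ (1 - m_τ) X_τ X_τᵀ` of one record to the information matrix. -/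
noncomputable def recordInfo (α : Coef J₀₀ J₁₀ J₁₁ → ℝ) (o : Obs p₀ p₁) :
    Matrix (Coef J₀₀ J₁₀ J₁₁) (Coef J₀₀ J₁₀ J₁₁) ℝ :=
  Matrix.of fun c d => ∑ τ : Fin 2, prob τ o α * (1 - prob τ o α) * design τ o c * design τ o d

/-- The bound `∑_τ M_τ (∑_c |X_τ,c|) ^ 3` on the third derivatives of the loss of one record in
the directions of norm one. -/
noncomputable def cubicBound (J₀₀ J₁₀ : Finset (Fin p₀)) (J₁₁ : Finset (Fin p₁))
    (M : Fin 2 → Obs p₀ p₁ → ℝ) (o : Obs p₀ p₁) : ℝ :=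
  ∑ τ : Fin 2, M τ o * (∑ c : Coef J₀₀ J₁₀ J₁₁, |design τ o c|) ^ 3

/-- The score of the first `n` records, divided by `√n`. -/
noncomputable def normalizedScore (n : ℕ) (x : ℕ → Obs p₀ p₁) (α : Coef J₀₀ J₁₀ J₁₁ → ℝ) :
    Coef J₀₀ J₁₀ J₁₁ → ℝ :=
  (√(n : ℝ))⁻¹ • ∑ i ∈ Finset.range n, score (x i) α

/-- A bound on the error of the quadratic approximation of the loss of `n` records at the points
`α + u / √n` with `‖u‖ ≤ C`. The two terms come from replacing the observed information by
`A` and from the third derivatives. -/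
noncomputable def expansionError (n : ℕ) (x : ℕ → Obs p₀ p₁) (α : Coef J₀₀ J₁₀ J₁₁ → ℝ)
    (A : Matrix (Coef J₀₀ J₁₀ J₁₁) (Coef J₀₀ J₁₀ J₁₁) ℝ) (M : Fin 2 → Obs p₀ p₁ → ℝ)
    (C : ℝ) : ℝ :=
  C ^ 2 / 2 * ∑ c, ∑ d, |(∑ i ∈ Finset.range n, recordInfo α (x i) c d) / n - A c d|
    + C ^ 3 / 6 * ((√(n : ℝ))⁻¹
      * ((∑ i ∈ Finset.range n, cubicBound J₀₀ J₁₀ J₁₁ M (x i)) / n))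

theorem prob_eq_sigmoid (τ : Fin 2) (o : Obs p₀ p₁) (α : Coef J₀₀ J₁₀ J₁₁ → ℝ) :
    prob τ o α = Real.sigmoid (α ⬝ᵥ design τ o) := rfl

theorem dotProduct_recordInfo_mulVec (α v : Coef J₀₀ J₁₀ J₁₁ → ℝ) (o : Obs p₀ p₁) :
    v ⬝ᵥ recordInfo α o *ᵥ v
      = ∑ τ : Fin 2, prob τ o α * (1 - prob τ o α) * (v ⬝ᵥ design τ o) ^ 2 := by
  have hmatrix : recordInfo α o = ∑ τ : Fin 2,
      (prob τ o α * (1 - prob τ o α)) • Matrix.vecMulVec (design τ o) (design τ o) := by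
    ext c d
    simp [recordInfo, Matrix.sum_apply, Matrix.vecMulVec_apply, mul_assoc]
  simp only [hmatrix, Matrix.sum_mulVec, dotProduct_sum, Matrix.smul_mulVec, dotProduct_smul,
    Matrix.vecMulVec_mulVec, op_smul_eq_smul, dotProduct_comm (design _ o) v, smul_eq_mul, sq]

theorem score_dotProduct (α v : Coef J₀₀ J₁₀ J₁₁ → ℝ) (o : Obs p₀ p₁) :
    score o α ⬝ᵥ v = ∑ τ : Fin 2, (trt τ o - prob τ o α) * (v ⬝ᵥ design τ o) := by
  have hscore : score o α = ∑ τ : Fin 2, (trt τ o - prob τ o α) • design τ o := by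
    ext c
    simp [score]
  simp only [hscore, sum_dotProduct, smul_dotProduct, smul_eq_mul, dotProduct_comm v]

theorem abs_recordLoss_add_sub_taylor_le {o : Obs p₀ p₁} {α v : Coef J₀₀ J₁₀ J₁₁ → ℝ}
    {M : Fin 2 → Obs p₀ p₁ → ℝ}
    (hM : ∀ τ, ∀ t ∈ Set.Icc (0 : ℝ) 1, |prob τ o (α + t • v) * (1 - prob τ o (α + t • v))
      * (1 - 2 * prob τ o (α + t • v))| ≤ M τ o) :
    |recordLoss o (α + v)
        - (recordLoss o α - score o α ⬝ᵥ v + 1 / 2 * (v ⬝ᵥ recordInfo α o *ᵥ v))|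
      ≤ ‖v‖ ^ 3 / 6 * cubicBound J₀₀ J₁₀ J₁₁ M o := by
  have hsoft : ∀ τ, |softplus (α ⬝ᵥ design τ o + v ⬝ᵥ design τ o)
      - (softplus (α ⬝ᵥ design τ o) + v ⬝ᵥ design τ o * prob τ o α
        + (v ⬝ᵥ design τ o) ^ 2 / 2 * (prob τ o α * (1 - prob τ o α)))|
      ≤ M τ o * |v ⬝ᵥ design τ o| ^ 3 / 6 := fun τ => by
    have htaylor := abs_sub_taylor_two_le contDiff_softplus (x := α ⬝ᵥ design τ o)
      (h := v ⬝ᵥ design τ o) (K := M τ o) fun t ht => by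
        simpa only [iteratedDeriv_three_softplus, prob_eq_sigmoid, add_dotProduct,
          smul_dotProduct, smul_eq_mul] using hM τ t ht
    simpa only [deriv_softplus, iteratedDeriv_two_softplus, prob_eq_sigmoid] using htaylor
  have hM0 : ∀ τ, 0 ≤ M τ o := fun τ => (abs_nonneg _).trans (hM τ 0 (by simp))
  rw [dotProduct_recordInfo_mulVec, score_dotProduct, cubicBound]
  simp only [recordLoss, add_dotProduct, Finset.mul_sum, ← Finset.sum_sub_distrib,
    ← Finset.sum_add_distrib]
  refine (Finset.abs_sum_le_sum_abs _ _).trans (Finset.sum_le_sum fun τ _ => ?_)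
  calc _ ≤ M τ o * |v ⬝ᵥ design τ o| ^ 3 / 6 := by
        refine le_of_eq_of_le (congrArg _ ?_) (hsoft τ)
        ring
    _ ≤ M τ o * (‖v‖ * ∑ c : Coef J₀₀ J₁₀ J₁₁, |design τ o c|) ^ 3 / 6 := by
        gcongr
        · exact hM0 τ
        · exact abs_dotProduct_le v _
    _ = ‖v‖ ^ 3 / 6 * (M τ o * (∑ c : Coef J₀₀ J₁₀ J₁₁, |design τ o c|) ^ 3) := by ring

theorem abs_negLogLik_sub_taylor_le {n : ℕ} (hn : n ≠ 0) {x : ℕ → Obs p₀ p₁}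
    {α u : Coef J₀₀ J₁₀ J₁₁ → ℝ} {M : Fin 2 → Obs p₀ p₁ → ℝ}
    (hM : ∀ τ i, ∀ t ∈ Set.Icc (0 : ℝ) 1, |prob τ (x i) (α + t • (√(n : ℝ))⁻¹ • u)
      * (1 - prob τ (x i) (α + t • (√(n : ℝ))⁻¹ • u))
      * (1 - 2 * prob τ (x i) (α + t • (√(n : ℝ))⁻¹ • u))| ≤ M τ (x i)) :
    |negLogLik n x (α + (√(n : ℝ))⁻¹ • u) - negLogLik n x α
        - (1 / 2 * (u ⬝ᵥ ((n : ℝ)⁻¹ • ∑ i ∈ Finset.range n, recordInfo α (x i)) *ᵥ u)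
          - normalizedScore n x α ⬝ᵥ u)|
      ≤ ‖u‖ ^ 3 / 6 * ((√(n : ℝ))⁻¹
        * ((∑ i ∈ Finset.range n, cubicBound J₀₀ J₁₀ J₁₁ M (x i)) / n)) := by
  set h : ℝ := (√(n : ℝ))⁻¹ with hh
  have hpos : 0 < h := inv_pos.2 (Real.sqrt_pos.2 (Nat.cast_pos.2 hn.bot_lt))
  have hsq : (n : ℝ)⁻¹ = h ^ 2 := by rw [hh, inv_pow, Real.sq_sqrt n.cast_nonneg]
  have hrecord := fun i => abs_recordLoss_add_sub_taylor_le fun τ t ht => hM τ i t ht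
  have hsum := (Finset.abs_sum_le_sum_abs _ _).trans
    (Finset.sum_le_sum fun i (_ : i ∈ Finset.range n) => hrecord i)
  refine le_of_eq_of_le (congrArg _ ?_) (hsum.trans_eq ?_)
  · simp only [negLogLik_eq_sum_recordLoss, normalizedScore, ← hh, hsq, Finset.sum_apply,
      Finset.sum_sub_distrib, Finset.sum_add_distrib, Matrix.smul_mulVec, Matrix.sum_mulVec,
      Matrix.mulVec_smul, dotProduct_smul, smul_dotProduct, dotProduct_sum, sum_dotProduct,
      smul_eq_mul, ← Finset.mul_sum]
    ring
  · rw [← Finset.mul_sum, norm_smul, Real.norm_of_nonneg hpos.le, div_eq_mul_inv _ (n : ℝ), hsq]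
    ring

theorem abs_negLogLik_sub_quadratic_le {n : ℕ} (hn : n ≠ 0) {x : ℕ → Obs p₀ p₁}
    {α u : Coef J₀₀ J₁₀ J₁₁ → ℝ} {r C : ℝ} {M : Fin 2 → Obs p₀ p₁ → ℝ}
    (A : Matrix (Coef J₀₀ J₁₀ J₁₁) (Coef J₀₀ J₁₀ J₁₁) ℝ)
    (hM : ∀ τ i, ∀ β ∈ Metric.ball α r, |prob τ (x i) β * (1 - prob τ (x i) β)
      * (1 - 2 * prob τ (x i) β)| ≤ M τ (x i))
    (hu : ‖u‖ ≤ C) (hC : C < r * √(n : ℝ)) :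
    |negLogLik n x (α + (√(n : ℝ))⁻¹ • u) - negLogLik n x α
        - (1 / 2 * (u ⬝ᵥ A *ᵥ u) - normalizedScore n x α ⬝ᵥ u)|
      ≤ expansionError n x α A M C := by
  have hsqrt : 0 < √(n : ℝ) := Real.sqrt_pos.2 (Nat.cast_pos.2 hn.bot_lt)
  have hball := fun t => add_smul_inv_smul_mem_ball (α := α) (t := t) hsqrt hu hC
  have hcubic : ∀ i, 0 ≤ cubicBound J₀₀ J₁₀ J₁₁ M (x i) := fun i =>
    Finset.sum_nonneg fun τ _ => mul_nonneg
      ((abs_nonneg _).trans (hM τ i _ (hball 0 (by simp)))) (by positivity)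
  set Ā := (n : ℝ)⁻¹ • ∑ i ∈ Finset.range n, recordInfo α (x i) with hĀ
  have htaylor := abs_negLogLik_sub_taylor_le hn fun τ i t ht => hM τ i _ (hball t ht)
  have hinfo := abs_dotProduct_mulVec_le (Ā - A) u
  have hentry : ∀ c d, (Ā - A) c d
      = (∑ i ∈ Finset.range n, recordInfo α (x i) c d) / n - A c d := fun c d => by
    simp [hĀ, Matrix.sum_apply, div_eq_inv_mul]
  simp only [hentry, Matrix.sub_mulVec, dotProduct_sub] at hinfo
  calc _ = |1 / 2 * (u ⬝ᵥ Ā *ᵥ u - u ⬝ᵥ A *ᵥ u)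
          + (negLogLik n x (α + (√(n : ℝ))⁻¹ • u) - negLogLik n x α
            - (1 / 2 * (u ⬝ᵥ Ā *ᵥ u) - normalizedScore n x α ⬝ᵥ u))| := by
        congr 1
        ring
    _ ≤ 1 / 2 * (‖u‖ ^ 2
          * ∑ c, ∑ d, |(∑ i ∈ Finset.range n, recordInfo α (x i) c d) / n - A c d|)
        + ‖u‖ ^ 3 / 6 * ((√(n : ℝ))⁻¹
          * ((∑ i ∈ Finset.range n, cubicBound J₀₀ J₁₀ J₁₁ M (x i)) / n)) := by
        refine (abs_add_le _ _).trans (add_le_add ?_ htaylor)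
        rw [abs_mul, abs_of_pos one_half_pos]
        gcongr
    _ ≤ expansionError n x α A M C := by
        rw [expansionError, ← mul_assoc, one_div_mul_eq_div]
        have := Finset.sum_nonneg fun i (_ : i ∈ Finset.range n) => hcubic i
        gcongr

end Expansion

section ExpansionInProbability

variable {p₀ p₁ : ℕ} {J₀₀ J₁₀ : Finset (Fin p₀)} {J₁₁ : Finset (Fin p₁)}
  {P : Measure (Obs p₀ p₁)} {α : Coef J₀₀ J₁₀ J₁₁ → ℝ}

theorem integrable_recordInfo (hfisher : FisherRegular P α) (c d : Coef J₀₀ J₁₀ J₁₁) :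
    Integrable (fun o => recordInfo α o c d) P := by
  simp only [recordInfo, Matrix.of_apply]
  exact integrable_finsetSum _ fun τ _ => hfisher.1 τ c d

theorem integral_recordInfo (hfisher : FisherRegular P α) (c d : Coef J₀₀ J₁₀ J₁₁) :
    ∫ o, recordInfo α o c d ∂P = fisherInfo P α c d := by
  simp only [recordInfo, fisherInfo, Matrix.of_apply]
  exact integral_finsetSum _ fun τ _ => hfisher.1 τ c d

theorem integrable_cubicBound {M : Fin 2 → Obs p₀ p₁ → ℝ}
    (hM : ∀ (τ : Fin 2) (c d e : Coef J₀₀ J₁₀ J₁₁), Integrable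
      (fun o => M τ o * |design τ o c * design τ o d * design τ o e|) P) :
    Integrable (cubicBound J₀₀ J₁₀ J₁₁ M) P := by
  refine integrable_finsetSum _ fun τ _ => ?_
  have hcube : (fun o => M τ o * (∑ c : Coef J₀₀ J₁₀ J₁₁, |design τ o c|) ^ 3)
      = fun o => ∑ c : Coef J₀₀ J₁₀ J₁₁, ∑ d : Coef J₀₀ J₁₀ J₁₁, ∑ e : Coef J₀₀ J₁₀ J₁₁,
        M τ o * |design τ o c * design τ o d * design τ o e| := by
    ext o
    simp only [abs_mul, ← Finset.mul_sum, ← Finset.sum_mul]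
    ring
  rw [hcube]
  exact integrable_finsetSum _ fun c _ => integrable_finsetSum _ fun d _ =>
    integrable_finsetSum _ fun e _ => hM τ c d e

variable {Ω : Type*} [MeasurableSpace Ω] {μ : Measure Ω} [IsProbabilityMeasure μ]
  {O : ℕ → Ω → Obs p₀ p₁}

theorem tendstoInMeasure_expansionError (hlaw : ∀ i, HasLaw (O i) P μ)
    (hindep : Pairwise fun i j => O i ⟂ᵢ[μ] O j) (hfisher : FisherRegular P α)
    {M : Fin 2 → Obs p₀ p₁ → ℝ} (hM : ∀ (τ : Fin 2) (c d e : Coef J₀₀ J₁₀ J₁₁), Integrable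
      (fun o => M τ o * |design τ o c * design τ o d * design τ o e|) P) (C : ℝ) :
    TendstoInMeasure μ
      (fun n ω => expansionError n (fun i => O i ω) α (fisherInfo P α) M C) atTop 0 := by
  have hcubic := integrable_cubicBound hM
  have hinfo := integrable_recordInfo hfisher
  refine tendstoInMeasure_of_tendsto_ae (fun n => ?_) ?_
  · refine ((Finset.aestronglyMeasurable_fun_sum _ fun c _ =>
      Finset.aestronglyMeasurable_fun_sum _ fun d _ => ?_).const_mul _).add
      (((aestronglyMeasurable_average hlaw hcubic.1 n).const_mul _).const_mul _)
    exact ((aestronglyMeasurable_average hlaw (hinfo c d).1 n).sub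
      aestronglyMeasurable_const).norm
  · filter_upwards [ae_tendsto_average hlaw hindep hcubic, ae_all_iff.2 fun c =>
      ae_all_iff.2 fun d => ae_tendsto_average hlaw hindep (hinfo c d)] with ω hω_cubic hω_info
    have hsqrt : Tendsto (fun n : ℕ => (√(n : ℝ))⁻¹) atTop (𝓝 0) :=
      tendsto_inv_atTop_zero.comp (Real.tendsto_sqrt_atTop.comp tendsto_natCast_atTop_atTop)
    have hentries := tendsto_finsetSum Finset.univ fun c _ => tendsto_finsetSum Finset.univ
      fun d _ => ((hω_info c d).sub_const (fisherInfo P α c d)).abs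
    have h := (hentries.const_mul (C ^ 2 / 2)).add
      ((hsqrt.mul hω_cubic).const_mul (C ^ 3 / 6))
    simpa only [integral_recordInfo hfisher, sub_self, abs_zero, Finset.sum_const_zero, mul_zero,
      zero_mul, add_zero, expansionError, Pi.zero_apply] using h

theorem boundedAboveInProb_sum_abs_normalizedScore [IsFiniteMeasure P]
    (hlaw : ∀ i, HasLaw (O i) P μ) (hindep : iIndepFun O μ) (hmodel : CorrectModel P α)
    (hfisher : FisherRegular P α) :
    BoundedAboveInProb μ fun n ω => ∑ c, |normalizedScore n (fun i => O i ω) α c| := by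
  refine BoundedAboveInProb.sum _ fun c => ?_
  have hmeas := measurable_score α c
  have hL2 := memLp_score hmodel hfisher c
  have hL2_comp : MemLp ((fun o => score o α c) ∘ O 0) 2 μ := by
    rw [← (hlaw 0).map_eq] at hL2
    exact hL2.comp_of_map (hlaw 0).aemeasurable
  have hmean : μ[(fun o => score o α c) ∘ O 0] = 0 := by
    rw [(hlaw 0).integral_comp hmeas.aestronglyMeasurable, integral_score hmodel hfisher]
  have h := boundedAboveInProb_abs_inv_sqrt_mul_sum (X := fun i => (fun o => score o α c) ∘ O i)
    hL2_comp hmean (hindep.comp _ fun _ => hmeas)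
    fun i => identDistrib_comp_of_hasLaw hlaw hmeas.aemeasurable i 0
  simpa only [normalizedScore, Pi.smul_apply, Finset.sum_apply, smul_eq_mul,
    Function.comp_apply] using h

end ExpansionInProbability

section ReducedQuadratic

theorem quadratic_add_sub {ι : Type*} [Fintype ι] {A : Matrix ι ι ℝ} (hA : A.IsSymm)
    (S v z : ι → ℝ) :
    (1 / 2 * ((v + z) ⬝ᵥ A *ᵥ (v + z)) - S ⬝ᵥ (v + z)) - (1 / 2 * (v ⬝ᵥ A *ᵥ v) - S ⬝ᵥ v)
      = 1 / 2 * (z ⬝ᵥ A *ᵥ z) + z ⬝ᵥ (A *ᵥ v - S) := by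
  have hcross : v ⬝ᵥ A *ᵥ z = z ⬝ᵥ A *ᵥ v := by
    rw [Matrix.dotProduct_mulVec, ← Matrix.mulVec_transpose, hA.eq, dotProduct_comm]
  rw [Matrix.mulVec_add, add_dotProduct, dotProduct_add, dotProduct_add, dotProduct_add,
    dotProduct_sub, dotProduct_comm z S, hcross]
  ring

theorem exists_pos_le_quadratic_of_norm_eq {ι : Type*} [Fintype ι] {A : Matrix ι ι ℝ}
    (hA : A.PosDef) {δ : ℝ} (hδ : 0 < δ) :
    ∃ η, 0 < η ∧ ∀ z : ι → ℝ, ‖z‖ = δ → η ≤ 1 / 2 * (z ⬝ᵥ A *ᵥ z) := by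
  rcases (Metric.sphere (0 : ι → ℝ) δ).eq_empty_or_nonempty with hempty | hne
  · exact ⟨1, one_pos, fun z hz =>
      absurd (mem_sphere_zero_iff_norm.2 hz) (hempty ▸ Set.notMem_empty z)⟩
  · have hcont : Continuous fun z : ι → ℝ => 1 / 2 * (z ⬝ᵥ A *ᵥ z) := by fun_prop
    obtain ⟨z₀, hz₀, hmin⟩ :=
      (isCompact_sphere (0 : ι → ℝ) δ).exists_isMinOn hne hcont.continuousOn
    have hpos := hA.dotProduct_mulVec_pos (ne_zero_of_mem_sphere hδ.ne' ⟨z₀, hz₀⟩)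
    exact ⟨_, mul_pos one_half_pos hpos, fun z hz => hmin (mem_sphere_zero_iff_norm.2 hz)⟩

variable {p₀ p₁ : ℕ} {J₀₀ J₁₀ : Finset (Fin p₀)} {J₁₁ : Finset (Fin p₁)}

/-- The information matrix `Rᵀ I R` of the reduced parameter, `R` being `expandMatrix α`. -/
noncomputable def reducedInfo (α : Coef J₀₀ J₁₀ J₁₁ → ℝ)
    (I : Matrix (Coef J₀₀ J₁₀ J₁₁) (Coef J₀₀ J₁₀ J₁₁) ℝ) : Matrix (Reduced α) (Reduced α) ℝ :=
  (expandMatrix α)ᵀ * I * expandMatrix α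

/-- The matrix `(Rᵀ I R)⁻¹ Rᵀ`, which takes the score `S` to the minimizer `y` of the reduced
quadratic `(R y)ᵀ I (R y) / 2 - Sᵀ (R y)`. -/
noncomputable def influence (α : Coef J₀₀ J₁₀ J₁₁ → ℝ)
    (I : Matrix (Coef J₀₀ J₁₀ J₁₁) (Coef J₀₀ J₁₀ J₁₁) ℝ) :
    Matrix (Reduced α) (Coef J₀₀ J₁₀ J₁₁) ℝ :=
  (reducedInfo α I)⁻¹ * (expandMatrix α)ᵀ

/-- The matrix `R (Rᵀ I R)⁻¹ Rᵀ`, which takes the score to the minimizer of the quadratic among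
the vectors with the equalities of `α`. -/
noncomputable def fusedInfluence (α : Coef J₀₀ J₁₀ J₁₁ → ℝ)
    (I : Matrix (Coef J₀₀ J₁₀ J₁₁) (Coef J₀₀ J₁₀ J₁₁) ℝ) :
    Matrix (Coef J₀₀ J₁₀ J₁₁) (Coef J₀₀ J₁₀ J₁₁) ℝ :=
  expandMatrix α * influence α I

variable {α : Coef J₀₀ J₁₀ J₁₁ → ℝ} {I : Matrix (Coef J₀₀ J₁₀ J₁₁) (Coef J₀₀ J₁₀ J₁₁) ℝ}

theorem posDef_reducedInfo (hI : I.PosDef) : (reducedInfo α I).PosDef := by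
  have h := hI.conjTranspose_mul_mul_same (expandMatrix_mulVec_injective α)
  rwa [Matrix.conjTranspose_eq_transpose_of_trivial] at h

theorem isSymm_of_posDef {ι : Type*} {A : Matrix ι ι ℝ} (hA : A.PosDef) : A.IsSymm := by
  rw [Matrix.IsSymm, ← Matrix.conjTranspose_eq_transpose_of_trivial]
  exact hA.isHermitian

theorem asymptoticCov_eq {P : Measure (Obs p₀ p₁)} (hI : (fisherInfo P α).PosDef) :
    asymptoticCov P α
      = influence α (fisherInfo P α) * scoreCov P α * (influence α (fisherInfo P α))ᵀ := by
  have hsymm : ((reducedInfo α (fisherInfo P α))⁻¹)ᵀ = (reducedInfo α (fisherInfo P α))⁻¹ := by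
    rw [Matrix.transpose_nonsing_inv, (isSymm_of_posDef (posDef_reducedInfo hI)).eq]
  rw [influence, Matrix.transpose_mul, hsymm, Matrix.transpose_transpose]
  simp only [asymptoticCov, reducedInfo, Matrix.mul_assoc]

theorem fusedInfluence_mulVec_apply (S : Coef J₀₀ J₁₀ J₁₁ → ℝ) (r : Reduced α) :
    (fusedInfluence α I *ᵥ S) r.1 = (influence α I *ᵥ S) r := by
  rw [fusedInfluence, ← Matrix.mulVec_mulVec, expandMatrix_mulVec_apply]

theorem gap_fusedInfluence_mulVec (S : Coef J₀₀ J₁₀ J₁₁ → ℝ) {k : ↥(J₀₀ ∩ J₁₀)}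
    (hk : k ∈ fused α) : gap k (fusedInfluence α I *ᵥ S) = 0 := by
  rw [fusedInfluence, ← Matrix.mulVec_mulVec, gap_expandMatrix_mulVec hk]

theorem transpose_expandMatrix_mulVec_gradient (hI : I.PosDef) (S : Coef J₀₀ J₁₀ J₁₁ → ℝ) :
    (expandMatrix α)ᵀ *ᵥ (I *ᵥ fusedInfluence α I *ᵥ S - S) = 0 := by
  have hdet : IsUnit (reducedInfo α I).det :=
    (Matrix.isUnit_iff_isUnit_det _).1 (posDef_reducedInfo hI).isUnit
  have hprod : (expandMatrix α)ᵀ * (I * fusedInfluence α I) = (expandMatrix α)ᵀ := by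
    rw [fusedInfluence, influence]
    simp only [← Matrix.mul_assoc]
    rw [← reducedInfo, Matrix.mul_nonsing_inv _ hdet, Matrix.one_mul]
  rw [Matrix.mulVec_sub, Matrix.mulVec_mulVec, Matrix.mulVec_mulVec, Matrix.mul_assoc, hprod,
    sub_self]

theorem neg_le_dotProduct_gradient (hI : I.PosDef) {S : Coef J₀₀ J₁₀ J₁₁ → ℝ} {g : ℝ}
    (hg : ∑ c, |(I *ᵥ fusedInfluence α I *ᵥ S - S) c| ≤ g) (z : Coef J₀₀ J₁₀ J₁₁ → ℝ) :
    -(g * ∑ k ∈ fused α, |gap k z|) ≤ z ⬝ᵥ (I *ᵥ fusedInfluence α I *ᵥ S - S) := by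
  set q := I *ᵥ fusedInfluence α I *ᵥ S - S with hq
  have horth : (z ∘ collapse α) ⬝ᵥ q = 0 := by
    rw [← expandMatrix_mulVec_restrict, dotProduct_comm, Matrix.dotProduct_mulVec,
      ← Matrix.mulVec_transpose, hq, transpose_expandMatrix_mulVec_gradient hI, zero_dotProduct]
  have hle : |(z ∘ collapse α - z) ⬝ᵥ q| ≤ (∑ k ∈ fused α, |gap k z|) * g := by
    refine (abs_dotProduct_le _ _).trans ?_
    gcongr
    exact norm_comp_collapse_sub_le α z
  rw [sub_dotProduct, horth, zero_sub, abs_neg] at hle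
  linarith [(abs_le.1 hle).1]

end ReducedQuadratic

section Oracle

theorem norm_le_sum_abs {ι : Type*} [Fintype ι] (y : ι → ℝ) : ‖y‖ ≤ ∑ i, |y i| :=
  (pi_norm_le_iff_of_nonneg (by positivity)).2 fun i =>
    Finset.single_le_sum (f := fun j => |y j|) (fun _ _ => abs_nonneg _) (Finset.mem_univ i)

theorem sum_abs_mulVec_le_of_sum_abs_le {ι κ : Type*} [Fintype ι] [Fintype κ] (A : Matrix κ ι ℝ)
    {S : ι → ℝ} {K : ℝ} (hS : ∑ i, |S i| ≤ K) :
    ∑ i, |(A *ᵥ S) i| ≤ K * ∑ i, ∑ j, |A i j| :=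
  (sum_abs_mulVec_le A S).trans
    (mul_le_mul_of_nonneg_right ((norm_le_sum_abs S).trans hS) (by positivity))

theorem sub_le_of_convexOn_of_abs_sub_le {E : Type*} [NormedAddCommGroup E] [NormedSpace ℝ E]
    {L : E → ℝ} (hconv : ConvexOn ℝ Set.univ L) {α u u' : E} {h B C : ℝ}
    (hB : ∀ y, ‖y‖ ≤ C → |L (α + h • y) - L α| ≤ B) (hu : ‖u‖ < C - 1) (hu' : ‖u'‖ < C - 1) :
    L (α + h • u') - L (α + h • u) ≤ 2 * B * ‖u' - u‖ := by
  have hB0 : 0 ≤ B := (abs_nonneg _).trans (hB u (by linarith))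
  have hconv' : ConvexOn ℝ (Metric.ball 0 C) fun y => L (α + h • y) - L α := by
    simp only [sub_eq_add_neg]
    exact (((hconv.translate_right α).comp_linearMap (h • LinearMap.id)).add_const (-L α)).subset
      (Set.subset_univ _) (convex_ball 0 C)
  have hlip := (hconv'.lipschitzOnWith_of_abs_le one_pos fun y hy =>
    hB y (mem_ball_zero_iff.1 hy).le).dist_le_mul u' (mem_ball_zero_iff.2 hu') u
      (mem_ball_zero_iff.2 hu)
  rw [div_one, Real.coe_toNNReal _ (by positivity), Real.dist_eq, dist_eq_norm,
    sub_sub_sub_cancel_right] at hlip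
  exact (le_abs_self _).trans hlip

variable {p₀ p₁ : ℕ} {J₀₀ J₁₀ : Finset (Fin p₀)} {J₁₁ : Finset (Fin p₁)}
  {α : Coef J₀₀ J₁₀ J₁₁ → ℝ} {I : Matrix (Coef J₀₀ J₁₀ J₁₁) (Coef J₀₀ J₁₀ J₁₁) ℝ}

theorem gap_add_inv_smul_ne_zero {u : Coef J₀₀ J₁₀ J₁₁ → ℝ} {s C : ℝ}
    (hs : 0 < s) (hu : ‖u‖ ≤ C) (hsep : ∀ k ∉ fused α, 2 * C < s * |gap k α|)
    {k : ↥(J₀₀ ∩ J₁₀)} (hk : k ∉ fused α) : gap k (α + s⁻¹ • u) ≠ 0 := fun h => by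
  rw [map_add, map_smul, smul_eq_mul, add_eq_zero_iff_eq_neg] at h
  have habs : s * |gap k α| = |gap k u| := by
    rw [h, abs_neg, abs_mul, abs_of_pos (inv_pos.2 hs), mul_inv_cancel_left₀ hs.ne']
  linarith [hsep k hk, abs_gap_le k u]

/-- Merging the pairs in `fused α` raises the loss by at most its local Lipschitz constant, of order
`2 * B * s`, times the sum of their gaps, and saves a penalty of slope at least `a * s`. -/
theorem fused_eq_of_isMinOn {L : (Coef J₀₀ J₁₀ J₁₁ → ℝ) → ℝ} (hconv : ConvexOn ℝ Set.univ L)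
    (hpos : ∀ β, 0 ≤ L β) {w : ↥(J₀₀ ∩ J₁₀) → ℝ≥0∞} {u : Coef J₀₀ J₁₀ J₁₁ → ℝ}
    {s a t B C : ℝ} (hs : 0 < s) (ht : 0 ≤ t) (hBa : 2 * B < a) (hu : ‖u‖ < C - 1)
    (hB : ∀ y, ‖y‖ ≤ C → |L (α + s⁻¹ • y) - L α| ≤ B)
    (hwT : ∀ k ∈ fused α, ENNReal.ofReal (a * s) ≤ w k)
    (hwF : ∀ k ∈ (fused α)ᶜ, w k ≤ ENNReal.ofReal (t * s))
    (hsep : ∀ k ∉ fused α, 2 * C < s * |gap k α|)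
    (hmin : IsMinOn (penalized L w gap) Set.univ (α + s⁻¹ • u)) :
    fused (α + s⁻¹ • u) = fused α := by
  have hB0 : 0 ≤ B := (abs_nonneg _).trans (hB u (by linarith))
  have hgap : ∀ k ∈ fused α, ∀ y, gap k (α + s⁻¹ • y) = s⁻¹ * gap k y := fun k hk y => by
    rw [map_add, mem_fused.1 hk, zero_add, map_smul, smul_eq_mul]
  have hpenalty : ∑ k ∈ fused α, |gap k u| = s * ∑ k ∈ fused α, |gap k (α + s⁻¹ • u)| := by
    rw [Finset.mul_sum]
    refine Finset.sum_congr rfl fun k hk => ?_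
    rw [hgap k hk, abs_mul, abs_of_pos (inv_pos.2 hs), mul_inv_cancel_left₀ hs.ne']
  have hloss : L (α + s⁻¹ • (u ∘ collapse α))
      ≤ L (α + s⁻¹ • u) + 2 * B * s * ∑ k ∈ fused α, |gap k (α + s⁻¹ • u)| := by
    have hlip := sub_le_of_convexOn_of_abs_sub_le hconv hB hu
      ((norm_comp_collapse_le α u).trans_lt hu)
    have hcollapse := mul_le_mul_of_nonneg_left (norm_comp_collapse_sub_le α u)
      (by positivity : 0 ≤ 2 * B)
    rw [hpenalty, ← mul_assoc] at hcollapse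
    linarith
  have hzero := eq_zero_of_isMinOn_penalized hpos hmin (by nlinarith) (by positivity)
    (mul_lt_mul_of_pos_right hBa hs)
    (fun k hk => by rw [hgap k hk, gap_comp_collapse_of_mem hk, mul_zero])
    (fun k hk => by
      simp only [map_add, map_smul, gap_comp_collapse_of_notMem (Finset.mem_compl.1 hk)])
    hwT hwF hloss
  ext k
  rw [mem_fused]
  exact ⟨fun h => by_contra fun hk =>
    gap_add_inv_smul_ne_zero hs (by linarith) hsep hk h, hzero k⟩

theorem add_lt_add_of_abs_sub_quadratic_le {L : (Coef J₀₀ J₁₀ J₁₁ → ℝ) → ℝ} (hI : I.PosDef)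
    {S : Coef J₀₀ J₁₀ J₁₁ → ℝ} {s a t ρ η C δ : ℝ} (ht : 0 ≤ t)
    (hquad : ∀ u, ‖u‖ ≤ C → |L (α + s⁻¹ • u) - L α - (1 / 2 * (u ⬝ᵥ I *ᵥ u) - S ⬝ᵥ u)| ≤ ρ)
    (hC : ‖fusedInfluence α I *ᵥ S‖ + δ ≤ C)
    (ha : ∑ c, |(I *ᵥ fusedInfluence α I *ᵥ S - S) c| ≤ a)
    (hη : ∀ z, ‖z‖ = δ → η ≤ 1 / 2 * (z ⬝ᵥ I *ᵥ z))
    (hρ : 2 * ρ + t * (Fintype.card ↥(J₀₀ ∩ J₁₀) * (2 * δ)) < η)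
    {z : Coef J₀₀ J₁₀ J₁₁ → ℝ} (hz : ‖z‖ = δ) :
    L (α + s⁻¹ • (fusedInfluence α I *ᵥ S)) + t * ∑ k ∈ (fused α)ᶜ, |gap k z|
      < L (α + s⁻¹ • (fusedInfluence α I *ᵥ S + z)) + a * ∑ k ∈ fused α, |gap k z| := by
  set v := fusedInfluence α I *ᵥ S
  have hδ : 0 ≤ δ := hz ▸ norm_nonneg z
  have hfree : t * ∑ k ∈ (fused α)ᶜ, |gap k z|
      ≤ t * (Fintype.card ↥(J₀₀ ∩ J₁₀) * (2 * δ)) := by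
    refine mul_le_mul_of_nonneg_left ?_ ht
    calc ∑ k ∈ (fused α)ᶜ, |gap k z| ≤ ∑ k, |gap k z| :=
          Finset.sum_le_univ_sum_of_nonneg fun _ => abs_nonneg _
      _ ≤ ∑ _k : ↥(J₀₀ ∩ J₁₀), 2 * δ := Finset.sum_le_sum fun k _ => hz ▸ abs_gap_le k z
      _ = Fintype.card ↥(J₀₀ ∩ J₁₀) * (2 * δ) := by
          rw [Finset.sum_const, Finset.card_univ, nsmul_eq_mul]
  have hquad_v := abs_le.1 (hquad v (by linarith))
  have hquad_vz := abs_le.1 (hquad (v + z) ((norm_add_le v z).trans (hz ▸ hC)))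
  linarith [quadratic_add_sub (isSymm_of_posDef hI) S v z, neg_le_dotProduct_gradient hI ha z,
    hη z hz, hquad_v.2, hquad_vz.1]

/-- The situation in which a minimizer of the penalized loss is found near `α`, at the scale
`s⁻¹`: the loss `L` is within `ρ` of the quadratic with gradient `-S` and Hessian `I`, the weights
of the truly equal coefficients are at least `a * s` and those of the other ones at most `t * s`,
and the latter are too far apart to be merged by a perturbation of size `C`. -/
structure OracleRegime (α : Coef J₀₀ J₁₀ J₁₁ → ℝ)
    (I : Matrix (Coef J₀₀ J₁₀ J₁₁) (Coef J₀₀ J₁₀ J₁₁) ℝ) (C ρ a t s : ℝ)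
    (L : (Coef J₀₀ J₁₀ J₁₁ → ℝ) → ℝ) (w : ↥(J₀₀ ∩ J₁₀) → ℝ≥0∞)
    (S : Coef J₀₀ J₁₀ J₁₁ → ℝ) : Prop where
  scale_pos : 0 < s
  abs_sub_quadratic_le : ∀ u, ‖u‖ ≤ C →
    |L (α + s⁻¹ • u) - L α - (1 / 2 * (u ⬝ᵥ I *ᵥ u) - S ⬝ᵥ u)| ≤ ρ
  le_weight : ∀ k ∈ fused α, ENNReal.ofReal (a * s) ≤ w k
  weight_le : ∀ k ∈ (fused α)ᶜ, w k ≤ ENNReal.ofReal (t * s)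
  lt_gap : ∀ k ∉ fused α, 2 * C < s * |gap k α|

theorem OracleRegime.abs_sub_le {C ρ a t s : ℝ} {L : (Coef J₀₀ J₁₀ J₁₁ → ℝ) → ℝ}
    {w : ↥(J₀₀ ∩ J₁₀) → ℝ≥0∞} {S : Coef J₀₀ J₁₀ J₁₁ → ℝ} (h : OracleRegime α I C ρ a t s L w S)
    {K : ℝ} (hS : ∑ c, |S c| ≤ K) {u : Coef J₀₀ J₁₀ J₁₁ → ℝ} (hu : ‖u‖ ≤ C) :
    |L (α + s⁻¹ • u) - L α| ≤ ρ + (1 / 2 * (C ^ 2 * ∑ c, ∑ d, |I c d|) + C * K) := by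
  have hC : 0 ≤ C := (norm_nonneg u).trans hu
  have hinfo : |u ⬝ᵥ I *ᵥ u| ≤ C ^ 2 * ∑ c, ∑ d, |I c d| :=
    (abs_dotProduct_mulVec_le I u).trans (by gcongr)
  have hscore : |u ⬝ᵥ S| ≤ C * K := (abs_dotProduct_le u S).trans (by gcongr)
  have happrox := h.abs_sub_quadratic_le u hu
  rw [dotProduct_comm u S] at hscore
  rw [abs_le] at *
  constructor <;> linarith [happrox.1, happrox.2, hinfo.1, hinfo.2, hscore.1, hscore.2]

theorem OracleRegime.exists_isMinOn_and_fused_eq {C ρ a t s : ℝ}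
    {L : (Coef J₀₀ J₁₀ J₁₁ → ℝ) → ℝ} {w : ↥(J₀₀ ∩ J₁₀) → ℝ≥0∞} {S : Coef J₀₀ J₁₀ J₁₁ → ℝ}
    (h : OracleRegime α I C ρ a t s L w S) (hI : I.PosDef) (hconv : ConvexOn ℝ Set.univ L)
    (hcont : Continuous L) (hpos : ∀ β, 0 ≤ L β) {K η δ : ℝ} (hδ : 0 < δ) (ht : 0 ≤ t)
    (hη : ∀ z, ‖z‖ = δ → η ≤ 1 / 2 * (z ⬝ᵥ I *ᵥ z)) (hS : ∑ c, |S c| ≤ K)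
    (hC : ‖fusedInfluence α I *ᵥ S‖ + δ + 1 ≤ C)
    (ha : ∑ c, |(I *ᵥ fusedInfluence α I *ᵥ S - S) c| ≤ a)
    (hBa : 2 * (ρ + (1 / 2 * (C ^ 2 * ∑ c, ∑ d, |I c d|) + C * K)) < a)
    (hρ : 2 * ρ + t * (Fintype.card ↥(J₀₀ ∩ J₁₀) * (2 * δ)) < η) :
    (∃ β, IsMinOn (penalized L w gap) Set.univ β) ∧
      ∀ β, IsMinOn (penalized L w gap) Set.univ β →
        ‖s • (β - α) - fusedInfluence α I *ᵥ S‖ < δ ∧ fused β = fused α := by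
  obtain ⟨hex, hclose⟩ := exists_isMinOn_penalized_and_norm_sub_lt hconv hcont hpos h.scale_pos hδ
    ((Finset.sum_nonneg fun _ _ => abs_nonneg _).trans ha) ht (fun k hk => mem_fused.1 hk)
    (fun k hk => gap_fusedInfluence_mulVec S hk) h.le_weight h.weight_le
    fun z hz => add_lt_add_of_abs_sub_quadratic_le hI ht h.abs_sub_quadratic_le
      (by linarith) ha hη hρ hz
  refine ⟨hex, fun β hβ => ⟨hclose β hβ, ?_⟩⟩
  obtain ⟨u, rfl⟩ : ∃ u, β = α + s⁻¹ • u :=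
    ⟨s • (β - α), by rw [inv_smul_smul₀ h.scale_pos.ne', add_sub_cancel]⟩
  have hu := hclose _ hβ
  rw [add_sub_cancel_left, smul_inv_smul₀ h.scale_pos.ne'] at hu
  exact fused_eq_of_isMinOn hconv hpos h.scale_pos ht hBa
    (by linarith [norm_sub_norm_le u (fusedInfluence α I *ᵥ S)])
    (fun y hy => h.abs_sub_le hS hy) h.le_weight h.weight_le h.lt_gap hβ

theorem exists_oracleRegime_constants (hI : I.PosDef)
    (α : Coef J₀₀ J₁₀ J₁₁ → ℝ) {δ : ℝ} (hδ : 0 < δ) {K : ℝ} (hK : 0 ≤ K) :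
    ∃ C ρ a t : ℝ, 0 < ρ ∧ 0 ≤ a ∧ 0 < t ∧
      ∀ {L : (Coef J₀₀ J₁₀ J₁₁ → ℝ) → ℝ} {w : ↥(J₀₀ ∩ J₁₀) → ℝ≥0∞}
        {S : Coef J₀₀ J₁₀ J₁₁ → ℝ} {s : ℝ},
      ConvexOn ℝ Set.univ L → Continuous L → (∀ β, 0 ≤ L β) → ∑ c, |S c| ≤ K →
      OracleRegime α I C ρ a t s L w S →
      (∃ β, IsMinOn (penalized L w gap) Set.univ β) ∧
        ∀ β, IsMinOn (penalized L w gap) Set.univ β →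
          ‖s • (β - α) - fusedInfluence α I *ᵥ S‖ < δ ∧ fused β = fused α := by
  obtain ⟨η, hη, hquad⟩ := exists_pos_le_quadratic_of_norm_eq hI hδ
  set V := K * ∑ c, ∑ d, |fusedInfluence α I c d|
  set G := K * ∑ c, ∑ d, |(I * fusedInfluence α I - 1) c d|
  set N := (Fintype.card ↥(J₀₀ ∩ J₁₀) : ℝ) * (2 * δ)
  set C := V + δ + 1
  set B := η / 8 + (1 / 2 * (C ^ 2 * ∑ c, ∑ d, |I c d|) + C * K)
  have ht : η / (2 * (N + 1)) * N ≤ η / 2 := by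
    rw [div_mul_eq_mul_div, div_le_div_iff₀ (by positivity) two_pos]
    nlinarith
  refine ⟨C, η / 8, max G (2 * B) + 1, η / (2 * (N + 1)), by positivity, by positivity,
    by positivity, fun {_ _ S _} hconv hcont hpos hS h => ?_⟩
  refine h.exists_isMinOn_and_fused_eq hI hconv hcont hpos hδ (by positivity) hquad hS ?_ ?_
    ((le_max_right G (2 * B)).trans_lt (lt_add_one _)) (by linarith)
  · linarith [norm_le_sum_abs (fusedInfluence α I *ᵥ S),
      sum_abs_mulVec_le_of_sum_abs_le (fusedInfluence α I) hS]
  · have hgrad : I *ᵥ fusedInfluence α I *ᵥ S - S = (I * fusedInfluence α I - 1) *ᵥ S := by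
      rw [Matrix.sub_mulVec, Matrix.one_mulVec, Matrix.mulVec_mulVec]
    rw [hgrad]
    linarith [sum_abs_mulVec_le_of_sum_abs_le (I * fusedInfluence α I - 1) hS,
      le_max_left G (2 * B)]

end Oracle

section WeightRates

theorem eventually_mul_sqrt_mul_rpow_le {lam : ℕ → ℝ} {γ : ℝ}
    (hlam₁ : Tendsto (fun n : ℕ => lam n * (n : ℝ) ^ ((γ - 1) / 2)) atTop atTop) (a : ℝ) {K : ℝ}
    (hK : 0 ≤ K) : ∀ᶠ n : ℕ in atTop, a * √(n : ℝ) * (K / √(n : ℝ)) ^ γ ≤ lam n := by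
  filter_upwards [hlam₁.eventually_ge_atTop (a * K ^ γ), eventually_gt_atTop 0] with n hn hn0
  have hn' : (0 : ℝ) < n := Nat.cast_pos.2 hn0
  have hpow : √(n : ℝ) * (K / √(n : ℝ)) ^ γ * (n : ℝ) ^ ((γ - 1) / 2) = K ^ γ := by
    rw [Real.div_rpow hK (Real.sqrt_nonneg _), Real.sqrt_eq_rpow, ← Real.rpow_mul hn'.le,
      show (γ - 1) / 2 = 1 / 2 * γ - 1 / 2 by ring, Real.rpow_sub hn']
    field_simp
  refine le_of_mul_le_mul_right ?_ (Real.rpow_pos_of_pos hn' ((γ - 1) / 2))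
  rwa [mul_assoc a, mul_assoc a, hpow]

variable {p₀ p₁ : ℕ} {J₀₀ J₁₀ : Finset (Fin p₀)} {J₁₁ : Finset (Fin p₁)}

theorem ofReal_le_fusionWeight {lam γ a : ℝ} {β : Coef J₀₀ J₁₀ J₁₁ → ℝ} {k : ↥(J₀₀ ∩ J₁₀)}
    (hlam : 0 < lam) (h : a * |gap k β| ^ γ ≤ lam) :
    ENNReal.ofReal a ≤ fusionWeight lam γ β k := by
  rw [fusionWeight, ENNReal.le_div_iff_mul_le (Or.inr (ENNReal.ofReal_pos.2 hlam).ne')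
    (Or.inl ENNReal.ofReal_ne_top), ← ENNReal.ofReal_mul' (by positivity)]
  exact ENNReal.ofReal_le_ofReal h

theorem fusionWeight_le_ofReal {lam γ b : ℝ} {β : Coef J₀₀ J₁₀ J₁₁ → ℝ} {k : ↥(J₀₀ ∩ J₁₀)}
    (h : lam ≤ b * |gap k β| ^ γ) : fusionWeight lam γ β k ≤ ENNReal.ofReal b := by
  refine ENNReal.div_le_of_le_mul ?_
  rw [← ENNReal.ofReal_mul' (by positivity)]
  exact ENNReal.ofReal_le_ofReal h

theorem eventually_le_fusionWeight {lam : ℕ → ℝ} {γ : ℝ} (hγ : 0 ≤ γ)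
    (hlam₁ : Tendsto (fun n : ℕ => lam n * (n : ℝ) ^ ((γ - 1) / 2)) atTop atTop) {a K : ℝ}
    (ha : 0 ≤ a) (hK : 0 ≤ K) :
    ∀ᶠ n : ℕ in atTop, ∀ (k : ↥(J₀₀ ∩ J₁₀)) (β : Coef J₀₀ J₁₀ J₁₁ → ℝ),
      √(n : ℝ) * |gap k β| ≤ K →
        ENNReal.ofReal (a * √(n : ℝ)) ≤ fusionWeight (lam n) γ β k := by
  filter_upwards [eventually_mul_sqrt_mul_rpow_le hlam₁ a hK, hlam₁.eventually_gt_atTop 0,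
    eventually_gt_atTop 0] with n hrate hpos hn k β hβ
  have hsqrt : 0 < √(n : ℝ) := Real.sqrt_pos.2 (Nat.cast_pos.2 hn)
  refine ofReal_le_fusionWeight
    (pos_of_mul_pos_left hpos (Real.rpow_nonneg (Nat.cast_nonneg n) _)) (le_trans ?_ hrate)
  gcongr
  rwa [le_div_iff₀' hsqrt]

theorem eventually_fusionWeight_le {lam : ℕ → ℝ} {γ : ℝ} (hγ : 0 ≤ γ)
    (hlam₀ : Tendsto (fun n : ℕ => lam n / √(n : ℝ)) atTop (𝓝 0)) {t g : ℝ} (ht : 0 < t)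
    (hg : g ≠ 0) (K : ℝ) (k : ↥(J₀₀ ∩ J₁₀)) :
    ∀ᶠ n : ℕ in atTop, ∀ β : Coef J₀₀ J₁₀ J₁₁ → ℝ,
      √(n : ℝ) * |gap k β - g| ≤ K →
        fusionWeight (lam n) γ β k ≤ ENNReal.ofReal (t * √(n : ℝ)) := by
  have hsqrt : Tendsto (fun n : ℕ => √(n : ℝ)) atTop atTop :=
    Real.tendsto_sqrt_atTop.comp tendsto_natCast_atTop_atTop
  have hg2 : 0 < |g| / 2 := half_pos (abs_pos.2 hg)
  filter_upwards [(hsqrt.atTop_mul_const hg2).eventually_ge_atTop K,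
    hlam₀.eventually_le_const (by positivity : 0 < t * (|g| / 2) ^ γ),
    hsqrt.eventually_gt_atTop 0] with n hKn hrate hn β hβ
  have hclose : |gap k β - g| ≤ |g| / 2 := le_of_mul_le_mul_left (hβ.trans hKn) hn
  have hhalf : |g| / 2 ≤ |gap k β| := by
    linarith [abs_sub_abs_le_abs_sub g (gap k β), abs_sub_comm g (gap k β)]
  refine fusionWeight_le_ofReal ?_
  calc lam n ≤ t * √(n : ℝ) * (|g| / 2) ^ γ := by
        rw [div_le_iff₀ hn] at hrate
        linarith
    _ ≤ t * √(n : ℝ) * |gap k β| ^ γ := by gcongr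

theorem eventually_oracleRegime {lam : ℕ → ℝ} {γ : ℝ} (hγ : 0 ≤ γ)
    (hlam₀ : Tendsto (fun n : ℕ => lam n / √(n : ℝ)) atTop (𝓝 0))
    (hlam₁ : Tendsto (fun n : ℕ => lam n * (n : ℝ) ^ ((γ - 1) / 2)) atTop atTop)
    (α : Coef J₀₀ J₁₀ J₁₁ → ℝ) (I : Matrix (Coef J₀₀ J₁₀ J₁₁) (Coef J₀₀ J₁₀ J₁₁) ℝ) {a t K : ℝ}
    (C ρ : ℝ) (ha : 0 ≤ a) (ht : 0 < t) (hK : 0 ≤ K) :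
    ∀ᶠ n : ℕ in atTop, ∀ (L : (Coef J₀₀ J₁₀ J₁₁ → ℝ) → ℝ) (S β : Coef J₀₀ J₁₀ J₁₁ → ℝ),
      (∀ u, ‖u‖ ≤ C → |L (α + (√(n : ℝ))⁻¹ • u) - L α
        - (1 / 2 * (u ⬝ᵥ I *ᵥ u) - S ⬝ᵥ u)| ≤ ρ) →
      (∀ k, √(n : ℝ) * |gap k (β - α)| ≤ K) →
      OracleRegime α I C ρ a t √(n : ℝ) L (fusionWeight (lam n) γ β) S := by
  have hsqrt : Tendsto (fun n : ℕ => √(n : ℝ)) atTop atTop :=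
    Real.tendsto_sqrt_atTop.comp tendsto_natCast_atTop_atTop
  have hfree : ∀ᶠ n : ℕ in atTop, ∀ k : ↥(J₀₀ ∩ J₁₀), k ∉ fused α →
      2 * C < √(n : ℝ) * |gap k α| ∧ ∀ β : Coef J₀₀ J₁₀ J₁₁ → ℝ,
        √(n : ℝ) * |gap k β - gap k α| ≤ K →
          fusionWeight (lam n) γ β k ≤ ENNReal.ofReal (t * √(n : ℝ)) := by
    refine eventually_all.2 fun k => eventually_imp_distrib_left.2 fun hk => ?_
    have hgap : gap k α ≠ 0 := fun h => hk (mem_fused.2 h)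
    exact ((hsqrt.atTop_mul_const (abs_pos.2 hgap)).eventually_gt_atTop _).and
      (eventually_fusionWeight_le hγ hlam₀ ht hgap K k)
  filter_upwards [hsqrt.eventually_gt_atTop 0, hfree,
    eventually_le_fusionWeight (J₁₁ := J₁₁) hγ hlam₁ ha hK] with n hn hfree hfused L S β hquad hβ
  exact {
    scale_pos := hn
    abs_sub_quadratic_le := hquad
    le_weight := fun k hk => hfused k β (by simpa [mem_fused.1 hk] using hβ k)
    weight_le := fun k hk => (hfree k (Finset.mem_compl.1 hk)).2 β (by simpa using hβ k)
    lt_gap := fun k hk => (hfree k hk).1 }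

end WeightRates

section SelectionConsistency

variable {Ω : Type*} [MeasurableSpace Ω] {μ : Measure Ω}

variable {p₀ p₁ : ℕ} {J₀₀ J₁₀ : Finset (Fin p₀)} {J₁₁ : Finset (Fin p₁)}
  {P : Measure (Obs p₀ p₁)} {α : Coef J₀₀ J₁₀ J₁₁ → ℝ} {O : ℕ → Ω → Obs p₀ p₁}

theorem boundedAboveInProb_sqrt_mul_abs_gap_sub {αinit : ℕ → Ω → Coef J₀₀ J₁₀ J₁₁ → ℝ}
    {k : ↥(J₀₀ ∩ J₁₀)}
    (h₀ : IsSqrtConsistent μ (fun n ω => αinit n ω (common0 k)) (α (common0 k)))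
    (h₁ : IsSqrtConsistent μ (fun n ω => αinit n ω (common1 k)) (α (common1 k))) :
    BoundedAboveInProb μ fun n ω => √(n : ℝ) * |gap k (αinit n ω - α)| := by
  refine (BoundedAboveInProb.add h₁ h₀).mono fun n ω => ?_
  rw [← mul_add, gap_apply]
  exact mul_le_mul_of_nonneg_left (abs_sub _ _) (Real.sqrt_nonneg _)

theorem exists_eventually_abs_negLogLik_sub_quadratic_le [IsProbabilityMeasure μ]
    (hlaw : ∀ i, HasLaw (O i) P μ) (hindep : Pairwise fun i j => O i ⟂ᵢ[μ] O j)
    (hfisher : FisherRegular P α) (hthird : ThirdDerivDominated P α) (C : ℝ) :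
    ∃ R : ℕ → Ω → ℝ, TendstoInMeasure μ R atTop 0 ∧ ∀ᶠ n : ℕ in atTop, ∀ᵐ ω ∂μ, ∀ u, ‖u‖ ≤ C →
      |negLogLik n (fun i => O i ω) (α + (√(n : ℝ))⁻¹ • u) - negLogLik n (fun i => O i ω) α
        - (1 / 2 * (u ⬝ᵥ fisherInfo P α *ᵥ u)
          - normalizedScore n (fun i => O i ω) α ⬝ᵥ u)| ≤ R n ω := by
  obtain ⟨U, M, hU, hαU, hdom, hint⟩ := hthird
  obtain ⟨r, hr, hball⟩ := Metric.isOpen_iff.1 hU α hαU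
  refine ⟨_, tendstoInMeasure_expansionError hlaw hindep hfisher hint C, ?_⟩
  have hdom_sample : ∀ᵐ ω ∂μ, ∀ τ i, ∀ β ∈ U, |prob τ (O i ω) β * (1 - prob τ (O i ω) β)
      * (1 - 2 * prob τ (O i ω) β)| ≤ M τ (O i ω) := by
    refine ae_all_iff.2 fun τ => ae_all_iff.2 fun i => ?_
    exact ae_of_ae_map (hlaw i).aemeasurable ((hlaw i).map_eq.symm ▸ hdom τ)
  have hsqrt : Tendsto (fun n : ℕ => r * √(n : ℝ)) atTop atTop :=
    (Real.tendsto_sqrt_atTop.comp tendsto_natCast_atTop_atTop).const_mul_atTop hr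
  filter_upwards [hsqrt.eventually_gt_atTop C, eventually_ne_atTop 0] with n hCn hn
  filter_upwards [hdom_sample] with ω hω u hu
  exact abs_negLogLik_sub_quadratic_le hn _ (fun τ i β hβ => hω τ i β (hball hβ)) hu hCn

theorem tendsto_measure_not_norm_sub_lt_and_fused_eq [IsFiniteMeasure P]
    [IsProbabilityMeasure μ] (hmodel : CorrectModel P α) (hfisher : FisherRegular P α)
    (hthird : ThirdDerivDominated P α) (hlaw : ∀ i, HasLaw (O i) P μ) (hindep : iIndepFun O μ)
    {γ : ℝ} (hγ : 0 ≤ γ) {lam : ℕ → ℝ}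
    (hlam₀ : Tendsto (fun n : ℕ => lam n / √(n : ℝ)) atTop (𝓝 0))
    (hlam₁ : Tendsto (fun n : ℕ => lam n * (n : ℝ) ^ ((γ - 1) / 2)) atTop atTop)
    {αinit αhat : ℕ → Ω → Coef J₀₀ J₁₀ J₁₁ → ℝ}
    (hinit : ∀ k, BoundedAboveInProb μ fun n ω => √(n : ℝ) * |gap k (αinit n ω - α)|)
    (hmin : ∀ n, ∀ᵐ ω ∂μ,
      (∃ β, IsMinimizer (lam n) γ n (fun i => O i ω) (αinit n ω) β) →
        IsMinimizer (lam n) γ n (fun i => O i ω) (αinit n ω) (αhat n ω))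
    {δ : ℝ} (hδ : 0 < δ) :
    Tendsto (fun n : ℕ => μ {ω | ¬ (‖√(n : ℝ) • (αhat n ω - α)
        - fusedInfluence α (fisherInfo P α) *ᵥ normalizedScore n (fun i => O i ω) α‖ < δ
      ∧ fused (αhat n ω) = fused α)}) atTop (𝓝 0) := by
  refine ((boundedAboveInProb_sum_abs_normalizedScore hlaw hindep hmodel hfisher).add
    (.sum Finset.univ hinit)).tendsto_measure_not_zero fun K => ?_
  obtain ⟨C, ρ, a, t, hρ, ha, ht, horacle⟩ :=
    exists_oracleRegime_constants hfisher.2 α hδ (le_max_right K 0)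
  obtain ⟨R, hR, hquad⟩ := exists_eventually_abs_negLogLik_sub_quadratic_le hlaw
    (fun _ _ => hindep.indepFun) hfisher hthird C
  refine ⟨R, hR, ρ, hρ, ?_⟩
  filter_upwards [hquad, eventually_oracleRegime hγ hlam₀ hlam₁ α (fisherInfo P α) C ρ ha ht
    (le_max_right K 0)] with n hquad_n hregime
  filter_upwards [hquad_n, hmin n] with ω hquad_ω hmin_ω hZ hRρ
  simp only [isMinimizer_iff] at hmin_ω
  have hscore : 0 ≤ ∑ c, |normalizedScore n (fun i => O i ω) α c| := by positivity
  have hgaps : ∀ k, 0 ≤ √(n : ℝ) * |gap k (αinit n ω - α)| := fun k => by positivity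
  have hsum := Finset.sum_nonneg fun k (_ : k ∈ Finset.univ) => hgaps k
  have hK := hZ.trans (le_max_left K 0)
  obtain ⟨hex, hall⟩ := horacle (convexOn_negLogLik n fun i => O i ω) (continuous_negLogLik n _)
    (negLogLik_nonneg n _) (by linarith)
    (hregime _ _ (αinit n ω) (fun u hu => (hquad_ω u hu).trans hRρ) fun k =>
      (Finset.single_le_sum (fun k _ => hgaps k) (Finset.mem_univ k)).trans (by linarith))
  exact hall _ (hmin_ω hex)

end SelectionConsistency

section LimitLaw

theorem tendsto_measure_one_of_imp {Ω : Type*} [MeasurableSpace Ω] {μ : Measure Ω}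
    [IsProbabilityMeasure μ] {p q : ℕ → Ω → Prop}
    (hp : Tendsto (fun n => μ {ω | ¬ p n ω}) atTop (𝓝 0)) (hpq : ∀ n ω, p n ω → q n ω) :
    Tendsto (fun n => μ {ω | q n ω}) atTop (𝓝 1) := by
  have hsub : Tendsto (fun n => 1 - μ {ω | ¬ p n ω}) atTop (𝓝 1) := by
    simpa only [tsub_zero] using ENNReal.Tendsto.sub (tendsto_const_nhds (x := (1 : ℝ≥0∞))) hp
      (Or.inl ENNReal.one_ne_top)
  refine tendsto_of_tendsto_of_tendsto_of_le_of_le hsub tendsto_const_nhds (fun n => ?_)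
    fun n => prob_le_one
  rw [tsub_le_iff_right, ← measure_univ (μ := μ)]
  exact (measure_mono fun ω _ => (em (p n ω)).imp_left (hpq n ω)).trans (measure_union_le _ _)

theorem tendstoInMeasure_clm_comp {Ω E F : Type*} [MeasurableSpace Ω] {μ : Measure Ω}
    [NormedAddCommGroup E] [NormedSpace ℝ E] [NormedAddCommGroup F] [NormedSpace ℝ F]
    (T : E →L[ℝ] F) {f : ℕ → Ω → E} (hf : TendstoInMeasure μ f atTop 0) :
    TendstoInMeasure μ (fun n ω => T (f n ω)) atTop 0 := by
  rw [tendstoInMeasure_iff_norm] at hf ⊢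
  intro ε hε
  refine tendsto_of_tendsto_of_tendsto_of_le_of_le tendsto_const_nhds
    (hf (ε / (‖T‖ + 1)) (by positivity)) (fun _ => zero_le) fun n => measure_mono fun ω => ?_
  simp only [Pi.zero_apply, sub_zero, Set.mem_ofPred_eq]
  intro hω
  rw [div_le_iff₀' (by positivity)]
  exact hω.trans (T.le_of_opNorm_le (by linarith) _)

theorem integral_mulVec_mul_mulVec {E κ ι : Type*} [MeasurableSpace E] {Q : Measure E} [Fintype κ]
    {X : E → κ → ℝ} (hX : ∀ c, MemLp (fun o => X o c) 2 Q) (A : Matrix ι κ ℝ) :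
    (Matrix.of fun a b => ∫ o, (A *ᵥ X o) a * (A *ᵥ X o) b ∂Q)
      = A * (Matrix.of fun c d => ∫ o, X o c * X o d ∂Q) * Aᵀ := by
  ext a b
  have hint : ∀ c d, Integrable (fun o => A a c * X o c * (A b d * X o d)) Q := fun c d =>
    ((hX c).const_mul (A a c)).integrable_mul ((hX d).const_mul (A b d))
  have hexpand : ∀ o, (A *ᵥ X o) a * (A *ᵥ X o) b = ∑ c, ∑ d, A a c * X o c * (A b d * X o d) :=
    fun o => Finset.sum_mul_sum ..
  simp only [Matrix.of_apply, hexpand, Matrix.mul_apply, Matrix.transpose_apply, Finset.sum_mul]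
  rw [integral_finsetSum _ fun c _ => integrable_finsetSum _ fun d _ => hint c d, Finset.sum_comm]
  refine Finset.sum_congr rfl fun c _ => ?_
  rw [integral_finsetSum _ fun d _ => hint c d]
  refine Finset.sum_congr rfl fun d _ => ?_
  simp only [mul_mul_mul_comm _ (X _ _), integral_const_mul]
  ring

theorem tendstoInDistribution_inv_sqrt_smul_sum_comp {Ω E ι : Type*} [MeasurableSpace Ω]
    [MeasurableSpace E] {μ : Measure Ω} [IsProbabilityMeasure μ] {P : Measure E} {O : ℕ → Ω → E}
    (hlaw : ∀ i, HasLaw (O i) P μ) (hindep : iIndepFun O μ) [Fintype ι] [DecidableEq ι]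
    {f : E → ι → ℝ} (hf : Measurable f) (hL2 : ∀ a, MemLp (fun o => f o a) 2 P)
    (hmean : ∀ a, ∫ o, f o a ∂P = 0) :
    TendstoInDistribution
      (fun (n : ℕ) ω => (√(n : ℝ))⁻¹ • ∑ i ∈ Finset.range n, WithLp.toLp 2 (f (O i ω))) atTop
      id (fun _ => μ) (multivariateGaussian 0 (Matrix.of fun a b => ∫ o, f o a * f o b ∂P)) := by
  have hcomp : Measurable fun o => WithLp.toLp 2 (f o) := by fun_prop
  have hintegral : ∀ {g : E → ℝ}, AEStronglyMeasurable g P → ∫ ω, g (O 0 ω) ∂μ = ∫ o, g o ∂P :=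
    fun hg => (hlaw 0).integral_comp hg
  have hclt := tendstoInDistribution_inv_sqrt_smul_sum
    (X := fun i => (fun o => WithLp.toLp 2 (f o)) ∘ O i)
    (fun a => ((hlaw 0).map_eq ▸ hL2 a).comp_of_map (hlaw 0).aemeasurable)
    (fun a => (hintegral (hL2 a).1).trans (hmean a)) (hindep.comp _ fun _ => hcomp)
    fun i => identDistrib_comp_of_hasLaw hlaw hcomp.aemeasurable i 0
  have hcov : (Matrix.of fun a b => ∫ ω, f (O 0 ω) a * f (O 0 ω) b ∂μ)
      = Matrix.of fun a b => ∫ o, f o a * f o b ∂P := by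
    ext a b
    exact hintegral ((hL2 a).1.mul (hL2 b).1)
  simpa only [Function.comp_apply, hcov] using hclt

variable {p₀ p₁ : ℕ} {J₀₀ J₁₀ : Finset (Fin p₀)} {J₁₁ : Finset (Fin p₁)}
  {P : Measure (Obs p₀ p₁)} {α : Coef J₀₀ J₁₀ J₁₁ → ℝ}

theorem posSemidef_asymptoticCov [IsFiniteMeasure P] (hmodel : CorrectModel P α)
    (hfisher : FisherRegular P α) : (asymptoticCov P α).PosSemidef := by
  have hscore : (scoreCov P α).PosSemidef := posSemidef_of_integral_mul (memLp_score hmodel hfisher)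
  rw [asymptoticCov_eq hfisher.2, ← Matrix.conjTranspose_eq_transpose_of_trivial]
  exact hscore.mul_mul_conjTranspose_same _

variable {Ω : Type*} [MeasurableSpace Ω] {μ : Measure Ω} [IsProbabilityMeasure μ]
  {O : ℕ → Ω → Obs p₀ p₁}

theorem tendstoInDistribution_mulVec_normalizedScore [IsFiniteMeasure P]
    (hlaw : ∀ i, HasLaw (O i) P μ) (hindep : iIndepFun O μ) (hmodel : CorrectModel P α)
    (hfisher : FisherRegular P α) {ι : Type*} [Fintype ι] [DecidableEq ι]
    (A : Matrix ι (Coef J₀₀ J₁₀ J₁₁) ℝ) :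
    TendstoInDistribution
      (fun n ω => WithLp.toLp 2 (A *ᵥ normalizedScore n (fun i => O i ω) α)) atTop id
      (fun _ => μ) (multivariateGaussian 0 (A * scoreCov P α * Aᵀ)) := by
  have hL2 := memLp_score hmodel hfisher
  have hmeas : Measurable fun o => A *ᵥ score o α := measurable_pi_lambda _ fun a =>
    Finset.measurable_fun_sum _ fun c _ => (measurable_score α c).const_mul (A a c)
  have hmean : ∀ a, ∫ o, (A *ᵥ score o α) a ∂P = 0 := fun a => by
    simp only [Matrix.mulVec, dotProduct]
    rw [integral_finsetSum _ fun c _ => ((hL2 c).integrable one_le_two).const_mul _]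
    simp only [integral_const_mul, integral_score hmodel hfisher, mul_zero, Finset.sum_const_zero]
  have hclt := tendstoInDistribution_inv_sqrt_smul_sum_comp hlaw hindep hmeas
    (fun a => memLp_finsetSum _ fun c _ => (hL2 c).const_mul (A a c)) hmean
  rw [integral_mulVec_mul_mulVec hL2] at hclt
  simpa only [normalizedScore, scoreCov, Matrix.mulVec_smul, Matrix.mulVec_sum, WithLp.toLp_smul,
    WithLp.toLp_sum] using hclt

/-- The linear map `β ↦ β_𝓑` that removes the redundant coordinates, with values in Euclidean
space. -/
noncomputable def reduce (α : Coef J₀₀ J₁₀ J₁₁ → ℝ) :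
    (Coef J₀₀ J₁₀ J₁₁ → ℝ) →L[ℝ] EuclideanSpace ℝ (Reduced α) :=
  (EuclideanSpace.equiv (Reduced α) ℝ).symm.toContinuousLinearMap ∘L
    .pi fun r => .proj (R := ℝ) (φ := fun _ => ℝ) r.1

theorem reduce_fusedInfluence_mulVec
    (I : Matrix (Coef J₀₀ J₁₀ J₁₁) (Coef J₀₀ J₁₀ J₁₁) ℝ) (S : Coef J₀₀ J₁₀ J₁₁ → ℝ) :
    reduce α (fusedInfluence α I *ᵥ S) = WithLp.toLp 2 (influence α I *ᵥ S) := by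
  ext r
  exact fusedInfluence_mulVec_apply S r

theorem tendstoInDistribution_reduce_sqrt_smul_sub [IsFiniteMeasure P]
    (hlaw : ∀ i, HasLaw (O i) P μ) (hindep : iIndepFun O μ) (hmodel : CorrectModel P α)
    (hfisher : FisherRegular P α) {αhat : ℕ → Ω → Coef J₀₀ J₁₀ J₁₁ → ℝ}
    (hmeas : ∀ n, AEMeasurable (αhat n) μ)
    (hclose : TendstoInMeasure μ (fun (n : ℕ) ω => √(n : ℝ) • (αhat n ω - α)
      - fusedInfluence α (fisherInfo P α) *ᵥ normalizedScore n (fun i => O i ω) α) atTop 0) :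
    TendstoInDistribution (fun (n : ℕ) ω => reduce α (√(n : ℝ) • (αhat n ω - α))) atTop id
      (fun _ => μ) (multivariateGaussian 0 (asymptoticCov P α)) := by
  have hclt := tendstoInDistribution_mulVec_normalizedScore hlaw hindep hmodel hfisher
    (influence α (fisherInfo P α))
  rw [← asymptoticCov_eq hfisher.2] at hclt
  refine tendstoInDistribution_of_tendstoInMeasure_sub _ _ hclt ?_ fun n =>
    (reduce α).measurable.comp_aemeasurable (by fun_prop)
  have h := tendstoInMeasure_clm_comp (reduce α) hclose
  simp only [map_sub, reduce_fusedInfluence_mulVec] at h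
  exact h

end LimitLaw

end FusedLasso

open FusedLasso

theorem mainTheorem1 {p₀ p₁ : ℕ} (J₀₀ J₁₀ : Finset (Fin p₀)) (J₁₁ : Finset (Fin p₁))
    (P : Measure (Obs p₀ p₁)) [IsProbabilityMeasure P]
    (αstar : Coef J₀₀ J₁₀ J₁₁ → ℝ)
    (hmodel : CorrectModel P αstar)
    (hfisher : FisherRegular P αstar)
    (hthird : ThirdDerivDominated P αstar)
    {Ω : Type*} [MeasurableSpace Ω] (μ : Measure Ω) [IsProbabilityMeasure μ]
    (O : ℕ → Ω → Obs p₀ p₁) (hOmeas : ∀ i, Measurable (O i))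
    (hOindep : iIndepFun O μ) (hOlaw : ∀ i, μ.map (O i) = P)
    (γ₁ : ℝ) (hγ : 0 < γ₁) (lam : ℕ → ℝ) (hlam : ∀ n, 0 ≤ lam n)
    (hlam₀ : Tendsto (fun n : ℕ => lam n / √(n : ℝ)) atTop (𝓝 0))
    (hlam₁ : Tendsto (fun n : ℕ => lam n * (n : ℝ) ^ ((γ₁ - 1) / 2)) atTop atTop)
    (αinit : ℕ → Ω → Coef J₀₀ J₁₀ J₁₁ → ℝ) (hinit : ∀ n, AEMeasurable (αinit n) μ)
    (hinit₀ : ∀ k : ↥(J₀₀ ∩ J₁₀), IsSqrtConsistent μ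
      (fun n ω => αinit n ω (common0 k)) (αstar (common0 k)))
    (hinit₁ : ∀ k : ↥(J₀₀ ∩ J₁₀), IsSqrtConsistent μ
      (fun n ω => αinit n ω (common1 k)) (αstar (common1 k)))
    (αhat : ℕ → Ω → Coef J₀₀ J₁₀ J₁₁ → ℝ) (hhat : ∀ n, AEMeasurable (αhat n) μ)
    -- the estimator is a minimizer whenever the criterion has one
    (hmin : ∀ n, ∀ᵐ ω ∂μ,
      (∃ β, IsMinimizer (lam n) γ₁ n (fun i => O i ω) (αinit n ω) β) →
        IsMinimizer (lam n) γ₁ n (fun i => O i ω) (αinit n ω) (αhat n ω)) :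
    Tendsto (fun n => μ {ω | fusedEdges (αhat n ω) = fusedEdges αstar}) atTop (𝓝 1) ∧
    Fintype.card (Reduced αstar) = numComponents αstar + 3 ∧
    (asymptoticCov P αstar).PosSemidef ∧
    TendstoInDistribution
      (fun (n : ℕ) ω => WithLp.toLp 2
        (fun r : Reduced αstar => √(n : ℝ) * (αhat n ω r.1 - αstar r.1)))
      atTop (id : EuclideanSpace ℝ (Reduced αstar) → EuclideanSpace ℝ (Reduced αstar))
      (fun _ => μ)
      (multivariateGaussian (0 : EuclideanSpace ℝ (Reduced αstar)) (asymptoticCov P αstar)) := by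
  have hlaw : ∀ i, HasLaw (O i) P μ := fun i => ⟨(hOmeas i).aemeasurable, hOlaw i⟩
  have hgap := fun k => boundedAboveInProb_sqrt_mul_abs_gap_sub (hinit₀ k) (hinit₁ k)
  have hbad := fun δ (hδ : (0 : ℝ) < δ) => tendsto_measure_not_norm_sub_lt_and_fused_eq hmodel
    hfisher hthird hlaw hOindep hγ.le hlam₀ hlam₁ hgap hmin hδ
  have hclose : TendstoInMeasure μ (fun (n : ℕ) ω => √(n : ℝ) • (αhat n ω - αstar)
      - fusedInfluence αstar (fisherInfo P αstar)
        *ᵥ normalizedScore n (fun i => O i ω) αstar) atTop 0 := by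
    refine tendstoInMeasure_iff_norm.2 fun ε hε => ?_
    refine tendsto_of_tendsto_of_tendsto_of_le_of_le tendsto_const_nhds (hbad ε hε)
      (fun _ => zero_le) fun n => measure_mono fun ω hω h => ?_
    simp only [Pi.zero_apply, sub_zero, Set.mem_ofPred_eq] at hω
    exact hω.not_gt h.1
  refine ⟨tendsto_measure_one_of_imp (hbad 1 one_pos) fun n ω h => ?_, card_reduced αstar,
    posSemidef_asymptoticCov hmodel hfisher,
    tendstoInDistribution_reduce_sqrt_smul_sub hlaw hOindep hmodel hfisher hhat hclose⟩
  rw [fusedEdges_eq_image, h.2, ← fusedEdges_eq_image]
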